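/- Let $\Omega=(p,q)\subset\mathbb R$ be a bounded open interval, $T>0$, $0<\alpha<1$, $0<\epsilon\le 2$, and let $a:[0,T]\to\mathbb R$ satisfy $c<a^2(t)<M$ and $|a^{-2}(t)-a^{-2}(s)|\le L|t-s|$ for all $s,t\in[0,T]$, where $c>0$. For $r\ge 0$ let $\dot H^r(\Omega)$ be the set of $v\in L^2(\Omega)$ with $\|v\|_{\dot H^r(\Omega)}^2=\sum_{j\ge1}\lambda_j^r(v,\varphi_j)^2<\infty$, where $(\lambda_j,\varphi_j)$ are the eigenvalues and $L^2$-normalized eigenfunctions of $-\Delta$ on $\Omega$ with homogeneous Dirichlet boundary condition. Let $${}_0D_t^{1-\alpha}W(t)=\frac{1}{\Gamma(\alpha)}\frac{\partial}{\partial t}\int_0^t (t-s)^{\alpha-1}W(s)\,ds .$$ Let $W_0\in\dot H^\epsilon(\Omega)$, and let $f:[0,T]\to L^2(\Omega)$ be absolutely continuous with $f(t)=f(0)+\int_0^t f'(s)\,ds$, $f'\in L^1(0,T;L^2(\Omega))$. Let $W$ be a solution of $$\partial_t W=\frac1{a^2(t)}\,\Delta\,{}_0D_t^{1-\alpha}W+f\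 \text{ in }\Omega\times(0,T],\qquad W(0)=W_0,\qquad W=0\ \text{ on }\partial\Omega\times(0,T],$$ in the following sense: $W\in C([0,T];L^2(\Omega))$, $W(0)=W_0$, $G(t)={}_0D_t^{1-\alpha}W(t)$ exists in $L^2(\Omega)$ for every $t\in(0,T]$, and for every smooth $v$ on $\overline\Omega$ with $v=0$ on $\partial\Omega$ and every $t\in(0,T]$, $$\frac{d}{dt}(W(t),v)=\frac1{a^2(t)}(G(t),v'')+(f(t),v)$$ (time derivatives at $t=T$ are one-sided). Then there is a constant $C>0$, depending only on $\Omega,T,\alpha,\epsilon,c,M,L$, such that for every $t\in(0,T]$ $$\|G(t)\|_{L^2(\Omega)}\le C\,t^{\alpha-1}\|W_0\|_{L^2(\Omega)}+C\|f(0)\|_{L^2(\Omega)}+C\int_0^t\|f'(s)\|_{L^2(\Omega)}\,ds,$$ and $G(t)\in\dot H^2(\Omega)$ with $$\|G(t)\|_{\dot H^2(\Omega)}\le C\,t^{\epsilon\alpha/2-1}\|W_0\|_{\dot H^\epsilon(\Omega)}+C\|f(0)\|_{L^2(\Omega)}+C\int_0^t\|f'(s)\|_{L^2(\Omega)}\,ds.$$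 -/

import Mathlib

open MeasureTheory Set
open scoped ContDiff

namespace FracFP

/-- The real Hilbert space `L²(Ω)` for the bounded domain (open interval) `Ω = (p, q) ⊂ ℝ`. -/
abbrev L2 (p q : ℝ) : Type := Lp ℝ 2 (volume.restrict (Ioo p q))

/-- The pairing `(u, v) = ∫_Ω u v dx` of `u ∈ L²(Ω)` with a function `v` on `ℝ`. -/
noncomputable def pair {p q : ℝ} (u : L2 p q) (v : ℝ → ℝ) : ℝ :=
  ∫ x in Ioo p q, (u : ℝ → ℝ) x * v x

/-- The Dirichlet eigenvalues of `A = -Δ` on `(p, q)` in non-decreasing order, the first one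
having index `j = 0`. -/
noncomputable def eigval (p q : ℝ) (j : ℕ) : ℝ :=
  (((j : ℝ) + 1) * Real.pi / (q - p)) ^ 2

/-- The corresponding Dirichlet eigenfunctions, normalized in `L²(p, q)`. -/
noncomputable def eigfun (p q : ℝ) (j : ℕ) (x : ℝ) : ℝ :=
  Real.sqrt (2 / (q - p)) * Real.sin (((j : ℝ) + 1) * Real.pi / (q - p) * (x - p))

/-- The eigenfunctions vanish on `∂Ω` and satisfy `-φ'' = λ φ`. -/
theorem eigfun_isDirichletEigenfunction {p q : ℝ} (hpq : p < q) (j : ℕ) :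
    eigfun p q j p = 0 ∧ eigfun p q j q = 0 ∧
      ∀ x, -deriv (deriv (eigfun p q j)) x = eigval p q j * eigfun p q j x := by
  have hne : q - p ≠ 0 := sub_ne_zero.mpr hpq.ne'
  refine ⟨by simp [eigfun], ?_, ?_⟩
  · have h : ((j : ℝ) + 1) * Real.pi / (q - p) * (q - p) = ((j + 1 : ℕ) : ℝ) * Real.pi := by
      push_cast
      field_simp
    simp only [eigfun]
    rw [h, Real.sin_nat_mul_pi, mul_zero]
  · intro x
    set m : ℝ := ((j : ℝ) + 1) * Real.pi / (q - p) with hm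
    have hl : ∀ y : ℝ, HasDerivAt (fun y => m * (y - p)) m y := fun y => by
      simpa using ((hasDerivAt_id y).sub_const p).const_mul m
    have h1 : deriv (eigfun p q j) =
        fun y => Real.sqrt (2 / (q - p)) * (Real.cos (m * (y - p)) * m) := by
      funext y
      exact (((hl y).sin).const_mul _).deriv
    have h2 : deriv (deriv (eigfun p q j)) x =
        Real.sqrt (2 / (q - p)) * (-Real.sin (m * (x - p)) * m * m) := by
      rw [h1]
      exact ((((hl x).cos).mul_const m).const_mul _).deriv
    rw [h2]
    simp only [eigfun, eigval, ← hm]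
    ring

/-- Membership in `Ḣ^r(Ω)`: `∑_j λ_j^r (v, φ_j)² < ∞`. -/
def MemHdot {p q : ℝ} (r : ℝ) (v : L2 p q) : Prop :=
  Summable fun j : ℕ => eigval p q j ^ r * pair v (eigfun p q j) ^ 2

/-- The norm of `Ḣ^r(Ω)`: `‖v‖² = ∑_j λ_j^r (v, φ_j)²` (meaningful if `MemHdot r v`). -/
noncomputable def hdotNorm {p q : ℝ} (r : ℝ) (v : L2 p q) : ℝ :=
  Real.sqrt (∑' j : ℕ, eigval p q j ^ r * pair v (eigfun p q j) ^ 2)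

/-- The Riemann–Liouville fractional integral
`₀I_t^α W = Γ(α)⁻¹ ∫_0^t (t - s)^(α-1) W(s) ds`, as a Bochner integral in `L²(Ω)`. -/
noncomputable def rlIntegral {p q : ℝ} (α : ℝ) (W : ℝ → L2 p q) (t : ℝ) : L2 p q :=
  (Real.Gamma α)⁻¹ • ∫ s in (0 : ℝ)..t, (t - s) ^ (α - 1) • W s

/-- The Riemann–Liouville fractional derivative `₀D_t^{1-α} W = ∂_t (₀I_t^α W)` on the time
interval `[0, T]` (a one-sided derivative at `t = T`), in the norm of `L²(Ω)`. -/
noncomputable def rlDeriv {p q : ℝ} (α T : ℝ) (W : ℝ → L2 p q) (t : ℝ) : L2 p q :=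
  derivWithin (rlIntegral α W) (Icc 0 T) t

/-- `W` solves, with `G = ₀D_t^{1-α} W` and homogeneous Dirichlet boundary condition,
`∂_t W = a(t)⁻² Δ G + f` on `Ω × (0, T]`, `W(0) = W₀`.

`W` is continuous on `[0, T]` with values in `L²(Ω)`, `G(t)` exists in `L²(Ω)` for every
`t ∈ (0, T]`, and the equation with its boundary condition is tested (after two integrations by
parts in space) with all smooth `v` vanishing on `∂Ω`. As `v'` is unrestricted on `∂Ω`, for a
regular `W` this says that the equation holds and that `G`, equivalently `W`, vanishes on
`∂Ω` for all `t ∈ (0, T]`. No regularity of `G(t)` beyond `L²(Ω)` is required. -/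
structure IsSolution {p q : ℝ} (α T : ℝ) (a : ℝ → ℝ) (f : ℝ → L2 p q) (W₀ : L2 p q)
    (W : ℝ → L2 p q) : Prop where
  continuousOn : ContinuousOn W (Icc 0 T)
  initial : W 0 = W₀
  differentiable : ∀ t ∈ Ioc 0 T, DifferentiableWithinAt ℝ (rlIntegral α W) (Icc 0 T) t
  equation : ∀ v : ℝ → ℝ, ContDiff ℝ ∞ v → v p = 0 → v q = 0 → ∀ t ∈ Ioc 0 T,
    HasDerivWithinAt (fun s => pair (W s) v)
      (1 / a t ^ 2 * pair (rlDeriv α T W t) (deriv (deriv v)) + pair (f t) v) (Icc 0 T) t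

end FracFP

/-! Testing with the Dirichlet eigenfunctions splits the equation into scalar problems. Write `k`
for `rlKernel α`, `w` for a coefficient of `W`, `y = k * w`, `g = y'` and `b = a⁻²`. Each mode
satisfies `w' = -λ b g + f`. Both bounds follow from estimates of `|g|` and `λ |g|` with constants
independent of `λ`, which are squared and summed with Parseval's identity (`hasSum_coeff_sq`) and
Minkowski's inequality.

For constant `b`, put `μ = λ b`. The problem is governed by the resolvent `e(t) = t^(α-1) E_{α,α}(-μ
t^α)`, which satisfies `e + μ k * e = k`; convolving the integrated equation with `e` gives `y = ∫
(w(0) e + f * e)`. What matters is `0 < e ≤ k`, `μ ∫ e ≤ 1` and `μ t e(t) ≤ α`. Interpolating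
between `e ≤ k` and `μ t e ≤ α` bounds `μ^(1-θ) e` by a multiple of `t^(θα-1)`; the choice `θ = ε/2`
yields the weight of the second estimate.

For variable `b`, the coefficient is frozen at the very time `t₀` at which `g` is to be bounded.
This adds the forcing `λ (b(t₀) - b(s)) g(s)`, of size at most `λ L (t₀ - s) |g(s)|`. Paired with
`e`, the factor `t₀ - s` gains `1/μ`, so `λ` cancels and `IsModeSolution.abs_le_add_integral` gives
`|g(t₀)| ≤ |w(0)| e(t₀) + Φ/μ + (L/b(t₀)) ∫ |g|`, where `Φ` bounds `|f|`. `gronwall_singular` closes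
the estimate.

This needs `g ∈ L¹`, which is not part of the notion of solution: `g` is only a pointwise derivative
on `(0, T]`. `IsModeSolution.intervalIntegrable` supplies it. Since `w + λ b y` is Lipschitz,
increments of `w` are controlled by those of `y`, which in turn are controlled by `k` convolved with
the increments of `w`. A fractional Gronwall inequality then bounds the difference quotients of `y`
in `L¹`, and Fatou's lemma passes to the limit. -/

/-! ### Convolution on the half line -/

/-- The causal convolution `∫_0^t f(s) g(t - s) ds`. -/
noncomputable def cv (f g : ℝ → ℝ) (t : ℝ) : ℝ := ∫ s in (0 : ℝ)..t, f s * g (t - s)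

theorem cv_comm (f g : ℝ → ℝ) (t : ℝ) : cv f g t = cv g f t := by
  have := intervalIntegral.integral_comp_sub_left (fun s => g s * f (t - s)) t (a := 0) (b := t)
  simp only [sub_sub_cancel, sub_self, sub_zero] at this
  rw [cv, cv, ← this]
  exact intervalIntegral.integral_congr fun s _ => mul_comm _ _

theorem cv_one (f : ℝ → ℝ) (t : ℝ) : cv (fun _ => 1) f t = ∫ s in (0 : ℝ)..t, f s := by
  rw [cv_comm]; simp [cv]

theorem cv_congr {f f' g g' : ℝ → ℝ} {t : ℝ} (ht : 0 ≤ t) (hf : ∀ s ∈ Ioo 0 t, f s = f' s)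
    (hg : ∀ s ∈ Ioo 0 t, g s = g' s) : cv f g t = cv f' g' t := by
  refine intervalIntegral.integral_congr_ae ?_
  have : ∀ᵐ s : ℝ, s ≠ t := by simp [ae_iff, measure_singleton]
  filter_upwards [this] with s hs hst
  rw [uIoc_of_le ht] at hst
  have h1 : s < t := lt_of_le_of_ne hst.2 hs
  rw [hf s ⟨hst.1, h1⟩, hg (t - s) ⟨by linarith, by linarith [hst.1]⟩]

/-- On `[0, T]` the causal convolution is the convolution of the truncations to `(0, T]`. -/
theorem cv_eq_convolution (f g : ℝ → ℝ) {T t : ℝ} (ht : t ≤ T) (h0 : 0 ≤ t) :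
    cv f g t = (convolution ((Ioc 0 T).indicator f) ((Ioc 0 T).indicator g)
      (ContinuousLinearMap.mul ℝ ℝ) volume) t := by
  rw [cv, intervalIntegral.integral_of_le h0, integral_Ioc_eq_integral_Ioo,
    ← integral_indicator measurableSet_Ioo, convolution_def]
  refine integral_congr_ae (Filter.Eventually.of_forall fun s => ?_)
  simp only [ContinuousLinearMap.mul_apply']
  by_cases hs : s ∈ Ioo 0 t
  · rw [indicator_of_mem hs, indicator_of_mem (show s ∈ Ioc 0 T from ⟨hs.1, hs.2.le.trans ht⟩),
      indicator_of_mem (show t - s ∈ Ioc 0 T from ⟨by linarith [hs.2], by linarith [hs.1]⟩)]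
  · rw [indicator_of_notMem hs]
    by_cases h1 : 0 < s
    · have : t - s ∉ Ioc 0 T := fun h => hs ⟨h1, by linarith [h.1]⟩
      rw [indicator_of_notMem this, mul_zero]
    · rw [indicator_of_notMem (fun h => h1 h.1), zero_mul]

theorem integrable_indicator_of_intervalIntegrable {f : ℝ → ℝ} {T : ℝ} (hT : 0 ≤ T)
    (hf : IntervalIntegrable f volume 0 T) : Integrable ((Ioc 0 T).indicator f) := by
  rw [integrable_indicator_iff measurableSet_Ioc]
  exact (intervalIntegrable_iff_integrableOn_Ioc_of_le hT).1 hf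

theorem intervalIntegrable_cv {f g : ℝ → ℝ} {T : ℝ} (hT : 0 ≤ T)
    (hf : IntervalIntegrable f volume 0 T) (hg : IntervalIntegrable g volume 0 T) :
    IntervalIntegrable (cv f g) volume 0 T := by
  have h := (integrable_indicator_of_intervalIntegrable hT hf).integrable_convolution
    (ContinuousLinearMap.mul ℝ ℝ) (integrable_indicator_of_intervalIntegrable hT hg)
  rw [intervalIntegrable_iff_integrableOn_Ioc_of_le hT]
  exact h.integrableOn.congr_fun (fun t ht => (cv_eq_convolution f g ht.2 ht.1.le).symm)
    measurableSet_Ioc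

/-- For bounded `g`, the integrand of `f * g` is integrable. -/
theorem intervalIntegrable_cv_integrand {f g : ℝ → ℝ} {T t : ℝ} (h0 : 0 ≤ t) (ht : t ≤ T)
    (hf : IntervalIntegrable f volume 0 T) (hg : IntervalIntegrable g volume 0 T)
    {C : ℝ} (hC : ∀ s ∈ Ioc 0 T, |g s| ≤ C) :
    IntervalIntegrable (fun s => f s * g (t - s)) volume 0 t := by
  have hf' : IntervalIntegrable f volume 0 t := hf.mono_set (by
    rw [uIcc_of_le h0, uIcc_of_le (h0.trans ht)]; exact Icc_subset_Icc_right ht)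
  have hg' : IntervalIntegrable g volume 0 t := hg.mono_set (by
    rw [uIcc_of_le h0, uIcc_of_le (h0.trans ht)]; exact Icc_subset_Icc_right ht)
  have hg'' : IntervalIntegrable (fun s => g (t - s)) volume 0 t := by
    simpa using (hg'.comp_sub_left t).symm
  rw [intervalIntegrable_iff_integrableOn_Ioc_of_le h0] at hf' hg'' ⊢
  rw [integrableOn_Ioc_iff_integrableOn_Ioo] at hf' hg'' ⊢
  refine hf'.mul_bdd (c := C) hg''.aestronglyMeasurable ?_
  refine (ae_restrict_iff' measurableSet_Ioo).2 (Filter.Eventually.of_forall fun s hs => ?_)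
  exact hC _ ⟨by linarith [hs.2], by linarith [hs.1]⟩

/-- Boundedness of one factor makes the triple integral absolutely convergent at every `t`, so the
identity holds pointwise and not merely almost everywhere. -/
theorem cv_assoc {f g h : ℝ → ℝ} {T t : ℝ} (h0 : 0 ≤ t) (ht : t ≤ T)
    (hf : IntervalIntegrable f volume 0 T) (hg : IntervalIntegrable g volume 0 T)
    (hh : IntervalIntegrable h volume 0 T) {C : ℝ} (hC : ∀ s ∈ Ioc 0 T, |f s| ≤ C) :
    cv (cv f g) h t = cv f (cv g h) t := by
  have hT : 0 ≤ T := h0.trans ht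
  have hF := integrable_indicator_of_intervalIntegrable hT hf
  have hG := integrable_indicator_of_intervalIntegrable hT hg
  have hH := integrable_indicator_of_intervalIntegrable hT hh
  set F := (Ioc 0 T).indicator f
  set G := (Ioc 0 T).indicator g
  set H := (Ioc 0 T).indicator h
  have key := convolution_assoc (ContinuousLinearMap.mul ℝ ℝ) (ContinuousLinearMap.mul ℝ ℝ)
    (ContinuousLinearMap.mul ℝ ℝ) (ContinuousLinearMap.mul ℝ ℝ) (f := F) (g := G) (k := H)
    (μ := volume) (ν := volume) (fun x y z => mul_assoc x y z) (x₀ := t)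
    hF.aestronglyMeasurable hG.aestronglyMeasurable hH.aestronglyMeasurable
    (hF.ae_convolution_exists _ hG) (hG.norm.ae_convolution_exists _ hH.norm) ?_
  · rw [cv_eq_convolution (cv f g) h ht h0, cv_eq_convolution f (cv g h) ht h0]
    -- Beyond `T` the convolution of the truncations need not vanish, so it matches the truncated
    -- `cv` only up to `T`. Times below `t` suffice, because the remaining factor is zero elsewhere.
    have e1 : ∀ u v : ℝ → ℝ, ∀ s, s < t →
        (convolution ((Ioc 0 T).indicator u) ((Ioc 0 T).indicator v)
          (ContinuousLinearMap.mul ℝ ℝ) volume) s = (Ioc 0 T).indicator (cv u v) s := by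
      intro u v s hs
      by_cases hs0 : 0 < s
      · rw [indicator_of_mem (show s ∈ Ioc 0 T from ⟨hs0, hs.le.trans ht⟩),
          cv_eq_convolution u v (hs.le.trans ht) hs0.le]
      · rw [indicator_of_notMem (fun h => hs0 h.1), convolution_def]
        refine integral_eq_zero_of_ae (Filter.Eventually.of_forall fun r => ?_)
        simp only [ContinuousLinearMap.mul_apply', Pi.zero_apply, mul_eq_zero]
        by_cases hr : 0 < r
        · right; exact indicator_of_notMem (fun h => by linarith [h.1]) _
        · left; exact indicator_of_notMem (fun h => hr h.1) _
    have hne : ∀ᵐ s : ℝ, s ≠ t := by simp [ae_iff, measure_singleton]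
    rw [convolution_def, convolution_def] at key
    rw [convolution_def, convolution_def]
    convert key using 1
    · refine integral_congr_ae ?_
      filter_upwards [hne] with s hs
      simp only [ContinuousLinearMap.mul_apply']
      rcases lt_or_gt_of_ne hs with hs | hs
      · rw [e1 f g s hs]
      · rw [indicator_of_notMem (fun h => by linarith [h.1] : t - s ∉ Ioc 0 T)]
        simp [H, indicator_of_notMem (fun h => by linarith [h.1] : t - s ∉ Ioc 0 T)]
    · refine integral_congr_ae (Filter.Eventually.of_forall fun s => ?_)
      simp only [ContinuousLinearMap.mul_apply']
      by_cases hs : 0 < s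
      · rw [e1 g h (t - s) (by linarith)]
      · simp [F, indicator_of_notMem (fun h => hs h.1 : s ∉ Ioc 0 T)]
  · have hI : Integrable (convolution (fun x => ‖G x‖) (fun x => ‖H x‖)
        (ContinuousLinearMap.mul ℝ ℝ) volume) := hG.norm.integrable_convolution _ hH.norm
    have hI' := hI.comp_sub_left t
    refine hI'.bdd_mul (c := C ⊔ 0) hF.norm.aestronglyMeasurable
      (Filter.Eventually.of_forall fun s => ?_)
    rw [norm_norm]
    by_cases hs : s ∈ Ioc 0 T
    · simp only [F, indicator_of_mem hs]
      exact (hC s hs).trans le_sup_left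
    · simp [F, indicator_of_notMem hs]

/-! ### The Riemann–Liouville kernel -/

/-- The kernel `t^(a-1) / Γ(a)` of the Riemann–Liouville integral of order `a`. -/
noncomputable def rlKernel (a t : ℝ) : ℝ := t ^ (a - 1) / Real.Gamma a

theorem rlKernel_pos {a t : ℝ} (ha : 0 < a) (ht : 0 < t) : 0 < rlKernel a t :=
  div_pos (Real.rpow_pos_of_pos ht _) (Real.Gamma_pos_of_pos ha)

theorem rlKernel_one : rlKernel 1 = fun _ => 1 := by
  funext t; simp [rlKernel]

theorem intervalIntegrable_rlKernel {a : ℝ} (ha : 0 < a) (s t : ℝ) :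
    IntervalIntegrable (rlKernel a) volume s t :=
  (intervalIntegral.intervalIntegrable_rpow' (by linarith)).div_const _

theorem cv_rlKernel {a b t : ℝ} (ha : 0 < a) (hb : 0 < b) (ht : 0 < t) :
    cv (rlKernel a) (rlKernel b) t = rlKernel (a + b) t := by
  have hA : 0 < (a : ℂ).re := by simpa
  have hB : 0 < (b : ℂ).re := by simpa
  have h1 := Complex.betaIntegral_scaled a b ht
  have h2 := Complex.Gamma_mul_Gamma_eq_betaIntegral hA hB
  have hΓ := (Real.Gamma_pos_of_pos (add_pos ha hb)).ne'
  have hΓa := (Real.Gamma_pos_of_pos ha).ne'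
  have hΓb := (Real.Gamma_pos_of_pos hb).ne'
  have h3 : ((∫ x in (0 : ℝ)..t, x ^ (a - 1) * (t - x) ^ (b - 1) : ℝ) : ℂ) =
      ((t ^ (a + b - 1) * (Real.Gamma a * Real.Gamma b / Real.Gamma (a + b)) : ℝ) : ℂ) := by
    rw [← intervalIntegral.integral_ofReal]
    trans ((t : ℂ) ^ ((a : ℂ) + b - 1) * Complex.betaIntegral a b)
    · rw [← h1]
      refine intervalIntegral.integral_congr fun x hx => ?_
      rw [uIcc_of_le ht.le] at hx
      rw [Complex.ofReal_mul, Complex.ofReal_cpow hx.1, Complex.ofReal_cpow (sub_nonneg.2 hx.2)]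
      push_cast
      rfl
    · rw [Complex.ofReal_mul, Complex.ofReal_cpow ht.le]
      congr 1
      · push_cast; rfl
      · rw [← Complex.ofReal_add, Complex.Gamma_ofReal, Complex.Gamma_ofReal,
          Complex.Gamma_ofReal] at h2
        have : (Real.Gamma (a + b) : ℂ) ≠ 0 := by exact_mod_cast hΓ
        push_cast
        rw [h2]
        field_simp
  have h4 := Complex.ofReal_injective h3
  have h5 : cv (rlKernel a) (rlKernel b) t =
      (Real.Gamma a * Real.Gamma b)⁻¹ * ∫ x in (0 : ℝ)..t, x ^ (a - 1) * (t - x) ^ (b - 1) := by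
    rw [cv, ← intervalIntegral.integral_const_mul]
    refine intervalIntegral.integral_congr fun x _ => ?_
    simp only [rlKernel]
    field_simp
  rw [h5, h4, rlKernel]
  field_simp

theorem integral_rlKernel {a t : ℝ} (ha : 0 < a) (ht : 0 < t) :
    ∫ s in (0 : ℝ)..t, rlKernel a s = rlKernel (a + 1) t := by
  rw [← cv_one, ← rlKernel_one, cv_rlKernel one_pos ha ht, add_comm]

theorem intervalIntegrable_rlKernel_mul {a b t : ℝ} (ha : 0 < a) (hb : 0 < b) (ht : 0 < t) :
    IntervalIntegrable (fun s => rlKernel a s * rlKernel b (t - s)) volume 0 t := by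
  refine intervalIntegral.intervalIntegrable_of_integral_ne_zero ?_
  have := cv_rlKernel ha hb ht
  rw [cv] at this
  rw [this]
  exact (rlKernel_pos (add_pos ha hb) ht).ne'

theorem rlKernel_anti {a s t : ℝ} (ha : 0 < a) (ha1 : a ≤ 1) (hs : 0 < s) (hst : s ≤ t) :
    rlKernel a t ≤ rlKernel a s :=
  div_le_div_of_nonneg_right (Real.rpow_le_rpow_of_nonpos hs hst (by linarith))
    (Real.Gamma_pos_of_pos ha).le

theorem mul_rlKernel {a t : ℝ} (ha : 0 < a) (ht : 0 < t) :
    t * rlKernel a t = a * rlKernel (a + 1) t := by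
  rw [rlKernel, rlKernel, Real.Gamma_add_one ha.ne', add_sub_cancel_right,
    Real.rpow_sub_one ht.ne']
  have := (Real.Gamma_pos_of_pos ha).ne'
  field_simp

/-! ### The Mittag-Leffler function -/

/-- Only the part `x > R` of the Gamma integral is kept, where `x^(s-1) ≥ R^(s-1)`. As `R` is free,
`Γ` outgrows every geometric sequence. -/
theorem rpow_mul_exp_neg_le_Gamma {R s : ℝ} (hR : 0 < R) (hs : 1 ≤ s) :
    R ^ (s - 1) * Real.exp (-R) ≤ Real.Gamma s := by
  rw [Real.Gamma_eq_integral (by linarith), ← integral_exp_neg_Ioi R, ← integral_const_mul]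
  have hc := Real.GammaIntegral_convergent (s := s) (by linarith)
  calc ∫ x in Ioi R, R ^ (s - 1) * Real.exp (-x)
      ≤ ∫ x in Ioi R, Real.exp (-x) * x ^ (s - 1) := by
        refine setIntegral_mono_on ((integrableOn_exp_neg_Ioi R).const_mul _)
          (hc.mono_set (Ioi_subset_Ioi hR.le)) measurableSet_Ioi fun x hx => ?_
        rw [mul_comm]
        have : R ^ (s - 1) ≤ x ^ (s - 1) :=
          Real.rpow_le_rpow hR.le (le_of_lt hx) (by linarith)
        gcongr
    _ ≤ _ := by
        refine setIntegral_mono_set hc ?_ (Ioi_subset_Ioi hR.le).eventuallyLE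
        refine (ae_restrict_iff' measurableSet_Ioi).2 (Filter.Eventually.of_forall fun x hx => ?_)
        have : (0 : ℝ) < x := hx
        simp only [Pi.zero_apply]
        positivity

theorem summable_pow_div_Gamma {α : ℝ} (hα : 0 < α) {x : ℝ} (hx : 0 ≤ x) :
    Summable fun n : ℕ => x ^ n / Real.Gamma ((n + 1) * α) := by
  -- Chosen so that `R^α = 2x + 1`: the series is then dominated by a geometric one of ratio `x /
  -- (2x + 1) < 1`.
  set R : ℝ := (2 * x + 1) ^ (1 / α) with hR
  have hR0 : 0 < R := by positivity
  have hRα : R ^ α = 2 * x + 1 := by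
    rw [hR, ← Real.rpow_mul (by positivity), one_div_mul_cancel hα.ne', Real.rpow_one]
  have hr : x / (2 * x + 1) < 1 := by
    rw [div_lt_one (by positivity)]; linarith
  have hg := (summable_geometric_of_lt_one (by positivity) hr).mul_left
    (Real.exp R * R ^ (1 - α))
  refine Summable.of_norm_bounded_eventually_nat hg ?_
  obtain ⟨N, hN⟩ := exists_nat_ge (1 / α)
  filter_upwards [Filter.eventually_ge_atTop N] with n hn
  have hn' : (N : ℝ) ≤ n := by exact_mod_cast hn
  have h1 : 1 ≤ (n + 1) * α := by
    rw [div_le_iff₀ hα] at hN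
    nlinarith
  have hG := rpow_mul_exp_neg_le_Gamma hR0 h1
  have hGp : 0 < Real.Gamma ((n + 1) * α) := Real.Gamma_pos_of_pos (by positivity)
  rw [Real.norm_of_nonneg (by positivity)]
  have e1 : R ^ ((n + 1) * α - 1) = (2 * x + 1) ^ n * R ^ (α - 1) := by
    rw [← hRα, ← Real.rpow_natCast, ← Real.rpow_mul hR0.le, ← Real.rpow_add hR0]
    congr 1; ring
  have e2 : R ^ (1 - α) * R ^ (α - 1) = 1 := by
    rw [← Real.rpow_add hR0]; simp
  rw [e1] at hG
  rw [div_le_iff₀ hGp, div_pow]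
  calc x ^ n = Real.exp R * R ^ (1 - α) * (x ^ n / (2 * x + 1) ^ n) *
        ((2 * x + 1) ^ n * R ^ (α - 1) * Real.exp (-R)) := by
        rw [Real.exp_neg]
        field_simp
        linear_combination (-x ^ n) * e2
    _ ≤ _ := by gcongr

/-- The Mittag-Leffler function `E_{α,α}`. -/
noncomputable def mittagLeffler (α x : ℝ) : ℝ := ∑' n : ℕ, x ^ n / Real.Gamma ((n + 1) * α)

theorem summable_mittagLeffler {α : ℝ} (hα : 0 < α) (x : ℝ) :
    Summable fun n : ℕ => x ^ n / Real.Gamma ((n + 1) * α) := by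
  refine Summable.of_norm ((summable_pow_div_Gamma hα (abs_nonneg x)).congr fun n => ?_)
  rw [norm_div, norm_pow, Real.norm_eq_abs, Real.norm_of_nonneg]
  exact (Real.Gamma_pos_of_pos (by positivity)).le

/-- The Mittag-Leffler function is Lipschitz on bounded sets. -/
theorem mittagLeffler_lipschitz {α : ℝ} (hα : 0 < α) {R : ℝ} (hR : 0 ≤ R) :
    ∃ K : ℝ, 0 ≤ K ∧ ∀ x y, |x| ≤ R → |y| ≤ R →
      |mittagLeffler α x - mittagLeffler α y| ≤ K * |x - y| := by
  have hs := summable_pow_div_Gamma hα (x := 2 * (R + 1)) (by positivity)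
  -- The factor `n` from `x^n - y^n` is absorbed by `2^n`, and the base `R + 1 ≥ 1` allows the
  -- exponent `n - 1` to be raised to `n`. Hence the Lipschitz constant is the series at `2 (R +
  -- 1)`.
  refine ⟨_, tsum_nonneg (L := .unconditional ℕ)
    (g := fun n : ℕ => (2 * (R + 1)) ^ n / Real.Gamma ((n + 1) * α))
    fun n => ?_, fun x y hx hy => ?_⟩
  · exact div_nonneg (by positivity) (Real.Gamma_pos_of_pos (by positivity)).le
  rw [mittagLeffler, mittagLeffler, ← (summable_mittagLeffler hα x).tsum_sub
    (summable_mittagLeffler hα y), ← tsum_mul_right, ← Real.norm_eq_abs]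
  refine tsum_of_norm_bounded (hs.mul_right _).hasSum fun n => ?_
  have hG : 0 < Real.Gamma ((n + 1) * α) := Real.Gamma_pos_of_pos (by positivity)
  rw [← sub_div, norm_div, Real.norm_of_nonneg hG.le, div_mul_eq_mul_div, Real.norm_eq_abs]
  refine div_le_div_of_nonneg_right ?_ hG.le
  have h2 : max |x| |y| ^ (n - 1) ≤ (R + 1) ^ n :=
    calc max |x| |y| ^ (n - 1) ≤ (R + 1) ^ (n - 1) := by
          have : max |x| |y| ≤ R + 1 := max_le (by linarith) (by linarith)
          gcongr
      _ ≤ (R + 1) ^ n := pow_le_pow_right₀ (by linarith) (Nat.sub_le _ _)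
  have h3 : (n : ℝ) ≤ 2 ^ n := by exact_mod_cast (Nat.lt_two_pow_self).le
  calc |x ^ n - y ^ n| ≤ |x - y| * n * max |x| |y| ^ (n - 1) := abs_pow_sub_pow_le x y n
    _ ≤ |x - y| * 2 ^ n * (R + 1) ^ n := by gcongr
    _ = (2 * (R + 1)) ^ n * |x - y| := by rw [mul_pow]; ring

theorem continuous_mittagLeffler {α : ℝ} (hα : 0 < α) : Continuous (mittagLeffler α) := by
  refine continuous_iff_continuousAt.2 fun x => ?_
  obtain ⟨K, hK, h⟩ := mittagLeffler_lipschitz hα (R := |x| + 1) (by positivity)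
  have hL : LipschitzOnWith K.toNNReal (mittagLeffler α) (Metric.ball x 1) :=
    LipschitzOnWith.of_dist_le_mul fun u hu v hv => by
      rw [Real.coe_toNNReal _ hK, Real.dist_eq, Real.dist_eq]
      rw [Metric.mem_ball, Real.dist_eq] at hu hv
      refine h u v ?_ ?_
      · linarith [abs_sub_abs_le_abs_sub u x]
      · linarith [abs_sub_abs_le_abs_sub v x]
  exact hL.continuousOn.continuousAt (Metric.ball_mem_nhds x one_pos)

theorem mittagLeffler_zero (α : ℝ) : mittagLeffler α 0 = 1 / Real.Gamma α := by
  rw [mittagLeffler, tsum_eq_single 0]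
  · simp
  · intro n hn; simp [hn]

/-- The resolvent `t^(α-1) E_{α,α}(-μ t^α)` of the Riemann–Liouville kernel. -/
noncomputable def rlResolvent (α μ t : ℝ) : ℝ := t ^ (α - 1) * mittagLeffler α (-μ * t ^ α)

theorem hasSum_rlResolvent {α : ℝ} (hα : 0 < α) (μ : ℝ) {t : ℝ} (ht : 0 < t) :
    HasSum (fun n : ℕ => (-μ) ^ n * rlKernel ((n + 1) * α) t) (rlResolvent α μ t) := by
  refine ((summable_mittagLeffler hα (-μ * t ^ α)).hasSum.mul_left (t ^ (α - 1))).congr_fun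
    fun n => ?_
  rw [rlKernel, mul_pow, ← Real.rpow_natCast (t ^ α), ← Real.rpow_mul ht.le]
  have : t ^ ((n + 1) * α - 1) = t ^ (α - 1) * t ^ (α * n) := by
    rw [← Real.rpow_add ht]; congr 1; ring
  rw [this]; ring

theorem continuousOn_rlResolvent {α : ℝ} (hα : 0 < α) (μ : ℝ) :
    ContinuousOn (rlResolvent α μ) (Ioi 0) := by
  refine ContinuousOn.mul ?_ ((continuous_mittagLeffler hα).comp_continuousOn ?_)
  · exact fun x hx => (Real.continuousAt_rpow_const _ _ (Or.inl hx.ne')).continuousWithinAt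
  · exact continuousOn_const.mul fun x hx =>
      (Real.continuousAt_rpow_const _ _ (Or.inl (ne_of_gt hx))).continuousWithinAt

theorem intervalIntegrable_rlResolvent {α : ℝ} (hα : 0 < α) (μ s t : ℝ) :
    IntervalIntegrable (rlResolvent α μ) volume s t := by
  refine (intervalIntegral.intervalIntegrable_rpow' (by linarith)).mul_continuousOn ?_
  refine ((continuous_mittagLeffler hα).comp ?_).continuousOn
  exact continuous_const.mul (Real.continuous_rpow_const hα.le)

/-- The resolvent equation. -/
theorem rlResolvent_add {α : ℝ} (hα : 0 < α) (μ : ℝ) {t : ℝ} (ht : 0 < t) :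
    rlResolvent α μ t + μ * cv (rlKernel α) (rlResolvent α μ) t = rlKernel α t := by
  have hpos : ∀ n : ℕ, 0 < ((n : ℝ) + 1) * α := fun n => by positivity
  have hint : ∀ n : ℕ, ∀ c : ℝ, ∫ s in Ioo 0 t, c * (rlKernel α s * rlKernel ((n + 1) * α) (t - s))
      = c * rlKernel ((n + 1 + 1) * α) t := fun n c => by
    rw [integral_const_mul, ← integral_Ioc_eq_integral_Ioo, ← intervalIntegral.integral_of_le ht.le]
    have := cv_rlKernel hα (hpos n) ht
    rw [cv] at this
    rw [this]; congr 2; ring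
  have hS : HasSum (fun n : ℕ => (-μ) ^ n * rlKernel ((n + 1 + 1) * α) t)
      (cv (rlKernel α) (rlResolvent α μ) t) := by
    have := hasSum_integral_of_summable_integral_norm (μ := volume.restrict (Ioo 0 t))
      (F := fun (n : ℕ) s => (-μ) ^ n * (rlKernel α s * rlKernel ((n + 1) * α) (t - s))) ?_ ?_
    · simp only [hint] at this
      suffices h : cv (rlKernel α) (rlResolvent α μ) t = _ by rw [h]; exact this
      rw [cv, intervalIntegral.integral_of_le ht.le, integral_Ioc_eq_integral_Ioo]
      refine setIntegral_congr_fun measurableSet_Ioo fun s hs => ?_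
      rw [← (hasSum_rlResolvent hα μ (sub_pos.2 hs.2)).tsum_eq, ← tsum_mul_left]
      congr 1; funext n; ring
    · intro n
      have := intervalIntegrable_rlKernel_mul hα (hpos n) ht
      rw [intervalIntegrable_iff_integrableOn_Ioo_of_le ht.le] at this
      exact this.const_mul _
    -- With `-|μ|` in place of `μ` all terms are nonnegative. The `L¹` norms are the terms of this
    -- series from index `1` on, divided by `|μ|`, so `μ = 0` is treated apart.
    · have := (hasSum_rlResolvent hα (-|μ|) ht).summable
      rw [← summable_nat_add_iff 1] at this
      by_cases hμ : μ = 0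
      · refine summable_of_ne_finset_zero (s := {0}) fun n hn => ?_
        have : n ≠ 0 := by simpa using hn
        simp [hμ, this]
      refine (this.mul_left |μ|⁻¹).congr fun n => ?_
      rw [← Real.norm_eq_abs] at *
      trans ∫ s in Ioo 0 t, |μ| ^ n * (rlKernel α s * rlKernel ((n + 1) * α) (t - s))
      · rw [hint]
        push_cast
        have : ‖μ‖ ≠ 0 := by simpa using hμ
        rw [Real.norm_eq_abs] at *
        rw [neg_neg, pow_succ]
        field_simp
      · refine setIntegral_congr_fun measurableSet_Ioo fun s hs => ?_
        have h1 := rlKernel_pos hα hs.1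
        have h2 := rlKernel_pos (hpos n) (sub_pos.2 hs.2)
        rw [norm_mul, norm_pow, norm_neg, Real.norm_of_nonneg (mul_pos h1 h2).le, Real.norm_eq_abs]
  have h0 := hasSum_rlResolvent hα μ ht
  rw [← hasSum_nat_add_iff' 1] at h0
  have h1 := h0.unique ((hS.mul_left (-μ)).congr_fun ?_)
  · simp at h1
    linarith
  · intro n; push_cast; ring

theorem intervalIntegrable_rlResolvent_mul {α : ℝ} (hα : 0 < α) (μ : ℝ) {t : ℝ} (ht : 0 < t) :
    IntervalIntegrable (fun s => rlResolvent α μ s * rlKernel α (t - s)) volume 0 t := by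
  have h := intervalIntegrable_rlKernel_mul hα hα ht
  have hc : Continuous fun s : ℝ => Real.Gamma α * mittagLeffler α (-μ * s ^ α) :=
    continuous_const.mul ((continuous_mittagLeffler hα).comp
      (continuous_const.mul (Real.continuous_rpow_const hα.le)))
  refine (h.mul_continuousOn hc.continuousOn).congr fun s _ => ?_
  have := (Real.Gamma_pos_of_pos hα).ne'
  simp only [rlKernel, rlResolvent]
  field_simp

/-! ### Positivity and decay of the resolvent. -/

theorem rlKernel_sub {α s t : ℝ} (hst : s ≤ t) (ht : 0 < t) :
    rlKernel α (t - s) = rlKernel α t * (1 - s / t) ^ (α - 1) := by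
  have : t - s = t * (1 - s / t) := by field_simp
  have h1 : 0 ≤ 1 - s / t := by rw [sub_nonneg, div_le_one ht]; exact hst
  rw [rlKernel, rlKernel, this, Real.mul_rpow ht.le h1]
  ring

theorem rpow_sub_rpow_ge {α u v : ℝ} (hα : α < 1) (hu : 0 < u) (huv : u ≤ v) (hv : v ≤ 1) :
    (1 - α) * (v - u) ≤ u ^ (α - 1) - v ^ (α - 1) := by
  have hv0 : 0 < v := hu.trans_le huv
  have h1 : u ^ (α - 1) - v ^ (α - 1) = v ^ (α - 1) * ((u / v) ^ (α - 1) - 1) := by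
    rw [Real.div_rpow hu.le hv0.le]
    have := (Real.rpow_pos_of_pos hv0 (α - 1)).ne'
    field_simp
  have hx : 0 < u / v := div_pos hu hv0
  have hx1 : u / v ≤ 1 := (div_le_one hv0).2 huv
  have h2 : 1 + (α - 1) * (u / v - 1) ≤ (u / v) ^ (α - 1) := by
    have h3 := Real.add_one_le_exp ((α - 1) * Real.log (u / v))
    rw [Real.rpow_def_of_pos hx, mul_comm (Real.log _)]
    have h4 := Real.log_le_sub_one_of_pos hx
    nlinarith
  have h5 : 1 ≤ v ^ (α - 1) := Real.one_le_rpow_of_pos_of_le_one_of_nonpos hv0 hv (by linarith)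
  have h6 : v - u ≤ 1 - u / v := by
    rw [show 1 - u / v = (v - u) / v by field_simp, le_div_iff₀ hv0]
    nlinarith
  have h7 : 0 ≤ (1 - α) * (v - u) := mul_nonneg (by linarith) (by linarith)
  rw [h1]
  calc (1 - α) * (v - u) ≤ (1 - α) * (1 - u / v) := by gcongr
    _ ≤ 1 * ((u / v) ^ (α - 1) - 1) := by linarith
    _ ≤ _ := by
      have : 0 ≤ (u / v) ^ (α - 1) - 1 := by
        have : 0 ≤ (1 - α) * (1 - u / v) := mul_nonneg (by linarith) (by linarith)
        linarith
      gcongr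

/-- Factoring `k(t)` out of the resolvent equation reduces the sign of `e(t)` to comparing one
integral with `1/μ`. Its weight `(1 - s/t)^(α-1)` decreases in `t`, which drives the positivity
proof. -/
theorem rlResolvent_eq {α : ℝ} (hα : 0 < α) (μ : ℝ) {t : ℝ} (ht : 0 < t) :
    rlResolvent α μ t = rlKernel α t *
      (1 - μ * ∫ s in (0 : ℝ)..t, rlResolvent α μ s * (1 - s / t) ^ (α - 1)) := by
  have h := rlResolvent_add hα μ ht
  have h2 : cv (rlKernel α) (rlResolvent α μ) t =
      rlKernel α t * ∫ s in (0 : ℝ)..t, rlResolvent α μ s * (1 - s / t) ^ (α - 1) := by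
    rw [cv_comm, cv, ← intervalIntegral.integral_const_mul]
    refine intervalIntegral.integral_congr fun s hs => ?_
    rw [uIcc_of_le ht.le] at hs
    rw [rlKernel_sub hs.2 ht]; ring
  rw [h2] at h
  linarith

theorem intervalIntegrable_rlResolvent_ratio {α : ℝ} (hα : 0 < α) (μ : ℝ) {t : ℝ} (ht : 0 < t) :
    IntervalIntegrable (fun s => rlResolvent α μ s * (1 - s / t) ^ (α - 1)) volume 0 t := by
  refine ((intervalIntegrable_rlResolvent_mul hα μ ht).const_mul (rlKernel α t)⁻¹).congr
    fun s hs => ?_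
  rw [uIoc_of_le ht.le] at hs
  have := (rlKernel_pos hα ht).ne'
  rw [rlKernel_sub hs.2 ht]
  field_simp

/-- The resolvent of the Riemann–Liouville kernel is positive. -/
theorem rlResolvent_pos {α μ : ℝ} (hα : 0 < α) (hα1 : α < 1) (hμ : 0 < μ) {t : ℝ} (ht : 0 < t) :
    0 < rlResolvent α μ t := by
  -- Let `t₁` be the first zero of the continuous factor `ψ`. By `rlResolvent_eq`, the weighted
  -- integral of `e` is below `1/μ` for `t < t₁` and at least `1/μ` at `t₁`. As `t` increases to
  -- `t₁`, however, the decreasing weight loses at least `c I (t₁ - t)`, while the new piece over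
  -- `(t, t₁)` adds only `o(t₁ - t)`, because `e` is at most of order `t₁ - s` there.
  by_contra hcon
  set ψ : ℝ → ℝ := fun t => mittagLeffler α (-μ * t ^ α) with hψ
  have hψc : Continuous ψ := (continuous_mittagLeffler hα).comp
    (continuous_const.mul (Real.continuous_rpow_const hα.le))
  have he : ∀ s, rlResolvent α μ s = s ^ (α - 1) * ψ s := fun s => rfl
  have hne : ({s | s ∈ Icc 0 t ∧ ψ s ≤ 0}).Nonempty := by
    refine ⟨t, ⟨ht.le, le_rfl⟩, ?_⟩
    by_contra h
    exact hcon (mul_pos (Real.rpow_pos_of_pos ht _) (not_le.1 h))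
  have hcpt : IsCompact {s | s ∈ Icc 0 t ∧ ψ s ≤ 0} :=
    isCompact_Icc.inter_right (isClosed_le hψc continuous_const)
  obtain ⟨t₁, ⟨ht₁, hψ₁⟩, hmin⟩ := hcpt.exists_isLeast hne
  have hψ0 : 0 < ψ 0 := by
    simp only [hψ, Real.zero_rpow hα.ne', mul_zero, mittagLeffler_zero]
    exact one_div_pos.2 (Real.Gamma_pos_of_pos hα)
  have ht₁0 : 0 < t₁ := lt_of_le_of_ne ht₁.1 fun h => by rw [← h] at hψ₁; linarith
  have hpos : ∀ s, 0 < s → s < t₁ → 0 < rlResolvent α μ s := fun s hs hst => by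
    refine mul_pos (Real.rpow_pos_of_pos hs _) ?_
    by_contra h
    exact absurd (hmin ⟨⟨hs.le, hst.le.trans ht₁.2⟩, not_lt.1 h⟩) (not_le.2 hst)
  obtain ⟨K, hK, hLip⟩ := mittagLeffler_lipschitz hα (R := μ * t₁ ^ α) (by positivity)
  set C := (t₁ / 2) ^ (α - 1) * (K * (μ * t₁ ^ (α - 1))) with hC
  have hbd : ∀ s, t₁ / 2 ≤ s → s < t₁ → rlResolvent α μ s ≤ C * (t₁ - s) := by
    intro s hs hst
    have hs0 : 0 < s := by linarith
    have h1 : s ^ (α - 1) ≤ (t₁ / 2) ^ (α - 1) :=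
      Real.rpow_le_rpow_of_nonpos (by positivity) hs (by linarith)
    have h2 : s ^ α ≤ t₁ ^ α := Real.rpow_le_rpow hs0.le hst.le hα.le
    have h3 := hLip (-μ * s ^ α) (-μ * t₁ ^ α)
      (by rw [neg_mul, abs_neg, abs_of_pos (by positivity)]; gcongr)
      (by rw [neg_mul, abs_neg, abs_of_pos (by positivity)])
    have h4 : |-μ * s ^ α - -μ * t₁ ^ α| = μ * (t₁ ^ α - s ^ α) := by
      rw [abs_of_nonneg]
      · ring
      · nlinarith
    have h5 : t₁ ^ α - s ^ α ≤ t₁ ^ (α - 1) * (t₁ - s) := by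
      have h6 : s / t₁ ≤ (s / t₁) ^ α := by
        have := Real.rpow_le_rpow_of_exponent_ge (div_pos hs0 ht₁0)
          ((div_le_one ht₁0).2 hst.le) hα1.le
        rwa [Real.rpow_one] at this
      rw [Real.div_rpow hs0.le ht₁0.le, div_le_div_iff₀ ht₁0 (by positivity)] at h6
      rw [Real.rpow_sub_one ht₁0.ne', div_mul_eq_mul_div, le_div_iff₀ ht₁0]
      nlinarith
    have h7 : ψ s ≤ K * (μ * (t₁ ^ (α - 1) * (t₁ - s))) := by
      rw [h4] at h3
      calc ψ s ≤ ψ s - ψ t₁ := by linarith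
        _ ≤ _ := le_abs_self _
        _ ≤ _ := h3
        _ ≤ _ := by gcongr
    have h8 : 0 ≤ K * (μ * (t₁ ^ (α - 1) * (t₁ - s))) := by
      have : 0 ≤ t₁ - s := by linarith
      positivity
    calc rlResolvent α μ s = s ^ (α - 1) * ψ s := rfl
      _ ≤ s ^ (α - 1) * (K * (μ * (t₁ ^ (α - 1) * (t₁ - s)))) := by gcongr
      _ ≤ (t₁ / 2) ^ (α - 1) * (K * (μ * (t₁ ^ (α - 1) * (t₁ - s)))) := by gcongr
      _ = C * (t₁ - s) := by rw [hC]; ring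
  have hC0 : 0 ≤ C := by positivity
  set r : ℝ → ℝ := fun s => (1 - s / t₁) ^ (α - 1) with hr
  have hrint : IntervalIntegrable r volume 0 t₁ := by
    have := ((intervalIntegrable_rlKernel hα 0 t₁).comp_sub_left t₁).symm
    simp only [sub_self, sub_zero] at this
    refine (this.const_mul (rlKernel α t₁)⁻¹).congr fun s hs => ?_
    rw [uIoc_of_le ht₁0.le] at hs
    have := (rlKernel_pos hα ht₁0).ne'
    simp only [hr]
    rw [rlKernel_sub hs.2 ht₁0]
    field_simp
  set I := ∫ s in (t₁ / 4)..(t₁ / 2), rlResolvent α μ s with hI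
  have hIpos : 0 < I := by
    refine intervalIntegral.intervalIntegral_pos_of_pos_on
      (intervalIntegrable_rlResolvent hα μ _ _) (fun s hs => hpos s ?_ ?_) (by linarith)
    · linarith [hs.1]
    · linarith [hs.2]
  -- The loss rate of the weight is at least `s (1 - α) / (t t₁)`, and `t < t₁ ≤ 4 s` for `s ∈
  -- [t₁/4, t₁/2]`.
  set c := (1 - α) / (4 * t₁) with hc
  have hc0 : 0 < c := div_pos (by linarith) (by linarith)
  have hG := intervalIntegrable_rlResolvent_ratio hα μ ht₁0
  have main : ∀ t ∈ Ioo (3 * t₁ / 4) t₁, c * I ≤ C * ∫ s in t..t₁, r s := by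
    intro t ht
    have ht0 : 0 < t := by linarith [ht.1]
    have hF := intervalIntegrable_rlResolvent_ratio hα μ ht0
    have h1 : μ * ∫ s in (0 : ℝ)..t, rlResolvent α μ s * (1 - s / t) ^ (α - 1) < 1 := by
      have := hpos t ht0 ht.2
      rw [rlResolvent_eq hα μ ht0] at this
      have := (mul_pos_iff_of_pos_left (rlKernel_pos hα ht0)).1 this
      linarith
    have h2 : 1 ≤ μ * ∫ s in (0 : ℝ)..t₁, rlResolvent α μ s * r s := by
      have h : rlResolvent α μ t₁ ≤ 0 :=
        mul_nonpos_of_nonneg_of_nonpos (Real.rpow_nonneg ht₁0.le _) hψ₁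
      rw [rlResolvent_eq hα μ ht₁0] at h
      by_contra h'
      exact absurd h (not_le.2 (mul_pos (rlKernel_pos hα ht₁0) (by linarith [not_le.1 h'])))
    have h3 := lt_of_mul_lt_mul_left (h1.trans_le h2) hμ.le
    have hsub1 : uIcc 0 t ⊆ uIcc 0 t₁ := by
      rw [uIcc_of_le ht0.le, uIcc_of_le ht₁0.le]; exact Icc_subset_Icc_right ht.2.le
    have hsub2 : uIcc t t₁ ⊆ uIcc 0 t₁ := by
      rw [uIcc_of_le ht.2.le, uIcc_of_le ht₁0.le]; exact Icc_subset_Icc_left ht0.le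
    have hG1 := hG.mono_set hsub1
    have hG2 := hG.mono_set hsub2
    rw [← intervalIntegral.integral_add_adjacent_intervals hG1 hG2] at h3
    have h4 : ∫ s in t..t₁, rlResolvent α μ s * r s ≤ ∫ s in t..t₁, C * (t₁ - t) * r s := by
      refine intervalIntegral.integral_mono_on_of_le_Ioo ht.2.le hG2
        ((hrint.mono_set hsub2).const_mul _) fun s hs => ?_
      have hr0 : 0 ≤ r s := by
        refine Real.rpow_nonneg ?_ _
        rw [sub_nonneg, div_le_one ht₁0]; exact hs.2.le
      have := hbd s (by linarith [hs.1, ht.1]) hs.2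
      have h9 : C * (t₁ - s) ≤ C * (t₁ - t) := by
        have := hs.1; gcongr
      exact mul_le_mul_of_nonneg_right (this.trans h9) hr0
    rw [intervalIntegral.integral_const_mul] at h4
    have hdiff : ∀ s ∈ Ioo 0 t, s * (t₁ - t) * (1 - α) / (t * t₁) ≤
        (1 - s / t) ^ (α - 1) - r s := by
      intro s hs
      have := rpow_sub_rpow_ge hα1 (u := 1 - s / t) (v := 1 - s / t₁)
        (by rw [sub_pos, div_lt_one ht0]; exact hs.2)
        (by have := hs.1.le; have := ht.2.le; gcongr)
        (by rw [sub_le_self_iff]; exact div_nonneg hs.1.le ht₁0.le)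
      refine le_trans (le_of_eq ?_) this
      field_simp
      ring
    have hDint : IntervalIntegrable (fun s => rlResolvent α μ s * ((1 - s / t) ^ (α - 1) - r s))
        volume 0 t := by
      refine (hF.sub hG1).congr fun s _ => ?_
      simp only [hr]; ring
    have h5 : (t₁ - t) * (c * I) ≤
        ∫ s in (0 : ℝ)..t, rlResolvent α μ s * ((1 - s / t) ^ (α - 1) - r s) := by
      have hs1 : (0 : ℝ) ≤ t₁ / 4 := by linarith
      have hs2 : t₁ / 4 ≤ t₁ / 2 := by linarith
      have hs3 : t₁ / 2 ≤ t := by linarith [ht.1]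
      calc (t₁ - t) * (c * I) = ∫ s in (t₁ / 4)..(t₁ / 2), (t₁ - t) * c * rlResolvent α μ s := by
            rw [intervalIntegral.integral_const_mul]; ring
        _ ≤ ∫ s in (t₁ / 4)..(t₁ / 2),
              rlResolvent α μ s * ((1 - s / t) ^ (α - 1) - r s) := by
            refine intervalIntegral.integral_mono_on hs2
              ((intervalIntegrable_rlResolvent hα μ _ _).const_mul _)
              (hDint.mono_set ?_) fun s hs => ?_
            · rw [uIcc_of_le hs2, uIcc_of_le ht0.le]; exact Icc_subset_Icc hs1 hs3
            · have hs0 : 0 < s := by linarith [hs.1]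
              rw [mul_comm]
              refine mul_le_mul_of_nonneg_left ?_ (hpos s hs0 (by linarith [hs.2])).le
              refine le_trans ?_ (hdiff s ⟨hs0, by linarith [hs.2, ht.1]⟩)
              rw [hc, mul_div_assoc', div_le_div_iff₀ (by positivity) (by positivity)]
              have h10 : 0 ≤ (t₁ - t) * (1 - α) * t₁ :=
                mul_nonneg (mul_nonneg (by linarith [ht.2]) (by linarith)) ht₁0.le
              have h11 : t ≤ 4 * s := by linarith [hs.1, ht.2]
              nlinarith
        _ ≤ _ := by
            refine intervalIntegral.integral_mono_interval hs1 hs2 hs3 ?_ hDint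
            rw [← restrict_Ioo_eq_restrict_Ioc]
            refine (ae_restrict_iff' measurableSet_Ioo).2
              (Filter.Eventually.of_forall fun s hs => ?_)
            refine mul_nonneg (hpos s hs.1 (hs.2.trans ht.2)).le (le_trans ?_ (hdiff s hs))
            have := hs.1
            refine div_nonneg (mul_nonneg (mul_nonneg this.le ?_) ?_) (by positivity) <;>
              linarith [ht.2]
    have h6 : ∫ s in (0 : ℝ)..t, rlResolvent α μ s * ((1 - s / t) ^ (α - 1) - r s) =
        (∫ s in (0 : ℝ)..t, rlResolvent α μ s * (1 - s / t) ^ (α - 1)) -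
          ∫ s in (0 : ℝ)..t, rlResolvent α μ s * r s := by
      rw [← intervalIntegral.integral_sub hF hG1]
      refine intervalIntegral.integral_congr fun s _ => ?_
      simp only [hr]; ring
    have h7 : (t₁ - t) * (c * I) ≤ (t₁ - t) * (C * ∫ s in t..t₁, r s) := by linarith
    exact le_of_mul_le_mul_left h7 (by linarith [ht.2])
  have hlim : Filter.Tendsto (fun t => C * ∫ s in t..t₁, r s) (nhdsWithin t₁ (Iio t₁))
      (nhds (C * 0)) := by
    refine Filter.Tendsto.const_mul C ?_
    have hI2 : IntegrableOn r (uIcc 0 t₁) := by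
      rw [uIcc_of_le ht₁0.le, integrableOn_Icc_iff_integrableOn_Ioc]
      exact (intervalIntegrable_iff_integrableOn_Ioc_of_le ht₁0.le).1 hrint
    have h1 := intervalIntegral.continuousOn_primitive_interval_left hI2
    have h2 := h1 t₁ right_mem_uIcc
    simp only [ContinuousWithinAt, intervalIntegral.integral_same] at h2
    refine h2.mono_left ?_
    rw [uIcc_of_le ht₁0.le]
    refine nhdsWithin_le_of_mem ?_
    filter_upwards [Ioo_mem_nhdsLT ht₁0] with s hs using ⟨hs.1.le, hs.2.le⟩
  have := ge_of_tendsto hlim (b := c * I) (by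
    filter_upwards [Ioo_mem_nhdsLT (show 3 * t₁ / 4 < t₁ by linarith)] with s hs using main s hs)
  rw [mul_zero] at this
  exact absurd this (not_le.2 (mul_pos hc0 hIpos))

theorem cv_nonneg {f g : ℝ → ℝ} {t : ℝ} (ht : 0 ≤ t) (hf : ∀ s ∈ Ioo 0 t, 0 ≤ f s)
    (hg : ∀ s ∈ Ioo 0 t, 0 ≤ g s) : 0 ≤ cv f g t := by
  rw [cv, intervalIntegral.integral_of_le ht, integral_Ioc_eq_integral_Ioo]
  exact setIntegral_nonneg measurableSet_Ioo fun s hs =>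
    mul_nonneg (hf s hs) (hg _ ⟨by linarith [hs.2], by linarith [hs.1]⟩)

theorem rlResolvent_le_rlKernel {α μ : ℝ} (hα : 0 < α) (hα1 : α < 1) (hμ : 0 < μ) {t : ℝ}
    (ht : 0 < t) : rlResolvent α μ t ≤ rlKernel α t := by
  have h := rlResolvent_add hα μ ht
  have h2 : 0 ≤ cv (rlKernel α) (rlResolvent α μ) t := cv_nonneg ht.le
    (fun s hs => (rlKernel_pos hα hs.1).le) fun s hs => (rlResolvent_pos hα hα1 hμ hs.1).le
  nlinarith [mul_nonneg hμ.le h2]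

/-- Positivity of `e` makes the bracket in `rlResolvent_eq` positive, and the weight there is at
least `1`. -/
theorem mul_integral_rlResolvent_le {α μ : ℝ} (hα : 0 < α) (hα1 : α < 1) (hμ : 0 < μ) {t : ℝ}
    (ht : 0 ≤ t) : μ * ∫ s in (0 : ℝ)..t, rlResolvent α μ s ≤ 1 := by
  rcases ht.eq_or_lt with rfl | ht
  · simp
  have h := rlResolvent_eq hα μ ht
  have h1 := (mul_pos_iff_of_pos_left (rlKernel_pos hα ht)).1 (h ▸ rlResolvent_pos hα hα1 hμ ht)
  have h2 : ∫ s in (0 : ℝ)..t, rlResolvent α μ s ≤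
      ∫ s in (0 : ℝ)..t, rlResolvent α μ s * (1 - s / t) ^ (α - 1) := by
    refine intervalIntegral.integral_mono_on_of_le_Ioo ht.le
      (intervalIntegrable_rlResolvent hα μ _ _) (intervalIntegrable_rlResolvent_ratio hα μ ht)
      fun s hs => ?_
    have h3 : 1 ≤ (1 - s / t) ^ (α - 1) := by
      refine Real.one_le_rpow_of_pos_of_le_one_of_nonpos ?_ ?_ (by linarith)
      · rw [sub_pos, div_lt_one ht]; exact hs.2
      · rw [sub_le_self_iff]; exact div_nonneg hs.1.le ht.le
    exact le_mul_of_one_le_right (rlResolvent_pos hα hα1 hμ hs.1).le h3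
  nlinarith

/-- Multiply the resolvent equation by `t`. Since `t k = α (1 * k)`, what results is `t e = α ∫ e -
μ k * (t e)`; the last term has a sign, and `μ ∫ e ≤ 1`. -/
theorem mul_rlResolvent_le {α μ : ℝ} (hα : 0 < α) (hα1 : α < 1) (hμ : 0 < μ) {t : ℝ}
    (ht : 0 < t) : μ * (t * rlResolvent α μ t) ≤ α := by
  have hp : ∀ s, 0 < s → 0 < rlResolvent α μ s := fun s hs => rlResolvent_pos hα hα1 hμ hs
  have hk := intervalIntegrable_rlKernel hα 0 t
  have he := intervalIntegrable_rlResolvent hα μ 0 t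
  -- `t (k * e) = (t k) * e + k * (t e)`
  have h1 : t * cv (rlKernel α) (rlResolvent α μ) t =
      cv (fun s => α * rlKernel (α + 1) s) (rlResolvent α μ) t +
        cv (rlKernel α) (fun s => s * rlResolvent α μ s) t := by
    have hI := (intervalIntegrable_rlResolvent_mul hα μ ht).comp_sub_left t
    simp only [sub_sub_cancel, sub_self, sub_zero] at hI
    replace hI := hI.symm
    have e1 : ∀ s ∈ uIoc 0 t, α * rlKernel (α + 1) s * rlResolvent α μ (t - s) =
        s * (rlResolvent α μ (t - s) * rlKernel α s) := fun s hs => by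
      rw [uIoc_of_le ht.le] at hs
      rw [← mul_rlKernel hα hs.1]; ring
    rw [cv, cv, cv, ← intervalIntegral.integral_const_mul, ← intervalIntegral.integral_add]
    · refine intervalIntegral.integral_congr_ae (Filter.Eventually.of_forall fun s hs => ?_)
      rw [e1 s hs]; ring
    · refine (hI.continuousOn_mul (g := fun s => s) (by fun_prop)).congr fun s hs => ?_
      exact (e1 s hs).symm
    · refine (hI.continuousOn_mul (g := fun s => t - s) (by fun_prop)).congr fun s hs => ?_
      ring
  have h2 : 0 ≤ cv (rlKernel α) (fun s => s * rlResolvent α μ s) t := cv_nonneg ht.le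
    (fun s hs => (rlKernel_pos hα hs.1).le) fun s hs => (mul_pos hs.1 (hp s hs.1)).le
  -- `(1 * k) * e = 1 * (k * e)`
  have h3 : cv (fun s => α * rlKernel (α + 1) s) (rlResolvent α μ) t =
      α * cv (fun _ => 1) (cv (rlKernel α) (rlResolvent α μ)) t := by
    rw [← cv_assoc ht.le le_rfl (by simp) hk he (C := 1) (by simp), cv, cv,
      ← intervalIntegral.integral_const_mul]
    refine intervalIntegral.integral_congr_ae (Filter.Eventually.of_forall fun s hs => ?_)
    rw [uIoc_of_le ht.le] at hs
    rw [cv_one, integral_rlKernel hα hs.1]; ring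
  have h4 : μ * cv (fun _ => 1) (cv (rlKernel α) (rlResolvent α μ)) t =
      rlKernel (α + 1) t - ∫ s in (0 : ℝ)..t, rlResolvent α μ s := by
    rw [cv_one, ← integral_rlKernel hα ht, ← intervalIntegral.integral_sub hk he,
      ← intervalIntegral.integral_const_mul]
    refine intervalIntegral.integral_congr_ae (Filter.Eventually.of_forall fun s hs => ?_)
    rw [uIoc_of_le ht.le] at hs
    linarith [rlResolvent_add hα μ hs.1]
  have h5 := rlResolvent_add hα μ ht
  have h6 := mul_rlKernel hα ht
  have h7 := mul_integral_rlResolvent_le hα hα1 hμ ht.le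
  have h8 : t * rlResolvent α μ t = α * (∫ s in (0 : ℝ)..t, rlResolvent α μ s) -
      μ * cv (rlKernel α) (fun s => s * rlResolvent α μ s) t := by
    have : t * rlResolvent α μ t = t * rlKernel α t -
        μ * (t * cv (rlKernel α) (rlResolvent α μ) t) := by rw [← h5]; ring
    rw [this, h6, h1, h3]
    linear_combination (-α) * h4
  have h9 : t * rlResolvent α μ t ≤ α * (∫ s in (0 : ℝ)..t, rlResolvent α μ s) := by
    rw [h8]; linarith [mul_nonneg hμ.le h2]
  calc μ * (t * rlResolvent α μ t) ≤ μ * (α * (∫ s in (0 : ℝ)..t, rlResolvent α μ s)) := by gcongr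
    _ = α * (μ * ∫ s in (0 : ℝ)..t, rlResolvent α μ s) := by ring
    _ ≤ α * 1 := by gcongr
    _ = α := mul_one _

/-- Interpolation between `rlResolvent_le_rlKernel` and `mul_rlResolvent_le`. -/
theorem rlResolvent_le_rpow {α μ : ℝ} (hα : 0 < α) (hα1 : α < 1) (hμ : 0 < μ) {θ : ℝ}
    (hθ0 : 0 ≤ θ) (hθ1 : θ ≤ 1) {t : ℝ} (ht : 0 < t) :
    μ ^ (1 - θ) * rlResolvent α μ t ≤ (1 / Real.Gamma α) ^ θ * t ^ (θ * α - 1) := by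
  have he := (rlResolvent_pos hα hα1 hμ ht).le
  have hG := Real.Gamma_pos_of_pos hα
  have h1 := rlResolvent_le_rlKernel hα hα1 hμ ht
  have h2 : μ * rlResolvent α μ t ≤ 1 / t := by
    rw [le_div_iff₀ ht]; linarith [mul_rlResolvent_le hα hα1 hμ ht]
  calc μ ^ (1 - θ) * rlResolvent α μ t
      = rlResolvent α μ t ^ θ * (μ * rlResolvent α μ t) ^ (1 - θ) := by
        rw [Real.mul_rpow hμ.le he, mul_left_comm, ← Real.rpow_add (rlResolvent_pos hα hα1 hμ ht)]
        simp
    _ ≤ rlKernel α t ^ θ * (1 / t) ^ (1 - θ) := by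
        have := (rlKernel_pos hα ht).le
        gcongr
    _ = _ := by
        rw [rlKernel, Real.div_rpow (by positivity) hG.le, Real.div_rpow one_pos.le hG.le,
          Real.one_rpow, Real.div_rpow one_pos.le ht.le, Real.one_rpow, ← Real.rpow_mul ht.le]
        have : t ^ (θ * α - 1) = t ^ ((α - 1) * θ) / t ^ (1 - θ) := by
          rw [← Real.rpow_sub ht]; congr 1; ring
        rw [this]; ring

/-! ### A fractional Gronwall inequality in `L¹` -/

/-- By Fubini the convolution of the truncations has total integral equal to the product;
restricting a nonnegative function to `(0, S]` can only lose mass. -/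
theorem integral_cv_le {F G : ℝ → ℝ} {S : ℝ} (hS : 0 ≤ S) (hF : IntervalIntegrable F volume 0 S)
    (hG : IntervalIntegrable G volume 0 S) (hF0 : ∀ s ∈ Ioc 0 S, 0 ≤ F s)
    (hG0 : ∀ s ∈ Ioc 0 S, 0 ≤ G s) :
    ∫ t in (0 : ℝ)..S, cv F G t ≤ (∫ t in (0 : ℝ)..S, F t) * ∫ t in (0 : ℝ)..S, G t := by
  have hF' := integrable_indicator_of_intervalIntegrable hS hF
  have hG' := integrable_indicator_of_intervalIntegrable hS hG
  have h := integral_convolution (ContinuousLinearMap.mul ℝ ℝ) hF' hG'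
  have hI := hF'.integrable_convolution (ContinuousLinearMap.mul ℝ ℝ) hG'
  rw [integral_indicator measurableSet_Ioc, integral_indicator measurableSet_Ioc,
    ContinuousLinearMap.mul_apply'] at h
  rw [intervalIntegral.integral_of_le hS, intervalIntegral.integral_of_le hS,
    intervalIntegral.integral_of_le hS, ← h]
  rw [setIntegral_congr_fun measurableSet_Ioc
    fun t ht => cv_eq_convolution F G ht.2 (le_of_lt ht.1)]
  refine setIntegral_le_integral hI (Filter.Eventually.of_forall fun t => ?_)
  refine integral_nonneg fun s => mul_nonneg ?_ ?_
  · exact indicator_nonneg hF0 s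
  · exact indicator_nonneg hG0 _

theorem integral_exp_mul_rlKernel_le {α ν S : ℝ} (hα : 0 < α) (hν : 0 < ν) (hS : 0 ≤ S) :
    ∫ s in (0 : ℝ)..S, Real.exp (-(ν * s)) * rlKernel α s ≤ (1 / ν) ^ α := by
  have h := Real.integral_rpow_mul_exp_neg_mul_Ioi hα hν
  have hG := Real.Gamma_pos_of_pos hα
  have hI : IntegrableOn (fun s : ℝ => s ^ (α - 1) * Real.exp (-(ν * s))) (Ioi 0) := by
    by_contra hc
    rw [integral_undef hc] at h
    have : 0 < (1 / ν) ^ α * Real.Gamma α := by positivity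
    linarith
  have h1 : ∫ s in Ioc 0 S, s ^ (α - 1) * Real.exp (-(ν * s)) ≤ (1 / ν) ^ α * Real.Gamma α := by
    rw [← h]
    refine setIntegral_mono_set hI ?_ Ioc_subset_Ioi_self.eventuallyLE
    refine (ae_restrict_iff' measurableSet_Ioi).2 (Filter.Eventually.of_forall fun x hx => ?_)
    exact mul_nonneg (Real.rpow_nonneg (le_of_lt hx) _) (Real.exp_nonneg _)
  rw [intervalIntegral.integral_of_le hS]
  calc ∫ s in Ioc 0 S, Real.exp (-(ν * s)) * rlKernel α s
      = (∫ s in Ioc 0 S, s ^ (α - 1) * Real.exp (-(ν * s))) / Real.Gamma α := by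
        rw [← integral_div]
        refine setIntegral_congr_fun measurableSet_Ioc fun s _ => ?_
        simp only [rlKernel]
        ring
    _ ≤ _ := by rwa [div_le_iff₀ hG]

/-- The weight `exp(-ν s)` distributes over causal convolutions and turns the norm of `k` in `L¹`
into at most `ν^(-α)`. For large `ν` the convolution term is absorbed on the left. -/
theorem fractional_gronwall_integral {α T A : ℝ} (hα : 0 < α) (hA : 0 ≤ A) :
    ∃ C : ℝ, 0 ≤ C ∧ ∀ S ∈ Icc 0 T, ∀ D H : ℝ → ℝ, IntervalIntegrable D volume 0 S →
      IntervalIntegrable H volume 0 S → (∀ t ∈ Ioc 0 S, 0 ≤ D t) → (∀ t ∈ Ioc 0 S, 0 ≤ H t) →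
      (∀ t ∈ Ioo 0 S, D t ≤ A * cv (rlKernel α) D t + H t) →
      ∫ t in (0 : ℝ)..S, D t ≤ C * ∫ t in (0 : ℝ)..S, H t := by
  -- Then `A ν^(-α) = A / (2A + 1) ≤ 1/2`.
  set ν : ℝ := (2 * A + 1) ^ (1 / α) with hν
  have hν0 : 0 < ν := by positivity
  have hνα : A * (1 / ν) ^ α ≤ 1 / 2 := by
    rw [Real.div_rpow one_pos.le hν0.le, Real.one_rpow, hν, ← Real.rpow_mul (by positivity),
      one_div_mul_cancel hα.ne', Real.rpow_one, mul_one_div, div_le_div_iff₀ (by positivity)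
      (by positivity)]
    linarith
  refine ⟨2 * Real.exp (ν * T), by positivity, fun S hS D H hD hH hD0 hH0 hle => ?_⟩
  set E : ℝ → ℝ := fun s => Real.exp (-(ν * s)) with hE
  have hEc : Continuous E := by fun_prop
  have hED := hD.continuousOn_mul (g := E) hEc.continuousOn
  have hEH := hH.continuousOn_mul (g := E) hEc.continuousOn
  have hEk := (intervalIntegrable_rlKernel hα 0 S).continuousOn_mul (g := E) hEc.continuousOn
  have hcv := intervalIntegrable_cv hS.1 hEk hED
  have hshift : ∀ t, E t * cv (rlKernel α) D t =
      cv (fun s => E s * rlKernel α s) (fun s => E s * D s) t := fun t => by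
    rw [cv, cv, ← intervalIntegral.integral_const_mul]
    refine intervalIntegral.integral_congr fun s _ => ?_
    have : E t = E s * E (t - s) := by
      simp only [hE]; rw [← Real.exp_add]; congr 1; ring
    simp only [this]; ring
  have h1 : ∫ t in (0 : ℝ)..S, E t * D t ≤
      A * ((1 / ν) ^ α * ∫ t in (0 : ℝ)..S, E t * D t) + ∫ t in (0 : ℝ)..S, E t * H t := by
    have hX : 0 ≤ ∫ t in (0 : ℝ)..S, E t * D t := by
      rw [intervalIntegral.integral_of_le hS.1]
      exact setIntegral_nonneg measurableSet_Ioc fun t ht =>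
        mul_nonneg (Real.exp_nonneg _) (hD0 t ht)
    calc ∫ t in (0 : ℝ)..S, E t * D t
        ≤ ∫ t in (0 : ℝ)..S, (A * cv (fun s => E s * rlKernel α s) (fun s => E s * D s) t
            + E t * H t) := by
          refine intervalIntegral.integral_mono_on_of_le_Ioo hS.1 hED
            ((hcv.const_mul A).add hEH) fun t ht => ?_
          rw [← hshift]
          have := mul_le_mul_of_nonneg_left (hle t ht) (Real.exp_nonneg (-(ν * t)))
          simp only [hE]
          linarith
      _ = A * (∫ t in (0 : ℝ)..S, cv (fun s => E s * rlKernel α s) (fun s => E s * D s) t)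
            + ∫ t in (0 : ℝ)..S, E t * H t := by
          rw [intervalIntegral.integral_add (hcv.const_mul A) hEH,
            intervalIntegral.integral_const_mul]
      _ ≤ A * ((∫ t in (0 : ℝ)..S, E t * rlKernel α t) * ∫ t in (0 : ℝ)..S, E t * D t)
            + ∫ t in (0 : ℝ)..S, E t * H t := by
          gcongr
          exact integral_cv_le hS.1 hEk hED
            (fun s hs => mul_nonneg (Real.exp_nonneg _) (rlKernel_pos hα hs.1).le)
            fun s hs => mul_nonneg (Real.exp_nonneg _) (hD0 s hs)
      _ ≤ _ := by
          gcongr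
          exact integral_exp_mul_rlKernel_le hα hν0 hS.1
  have hX : 0 ≤ ∫ t in (0 : ℝ)..S, E t * D t := by
    rw [intervalIntegral.integral_of_le hS.1]
    exact setIntegral_nonneg measurableSet_Ioc fun t ht =>
      mul_nonneg (Real.exp_nonneg _) (hD0 t ht)
  have h2 : ∫ t in (0 : ℝ)..S, E t * H t ≤ ∫ t in (0 : ℝ)..S, H t := by
    refine intervalIntegral.integral_mono_on_of_le_Ioo hS.1 hEH hH fun t ht => ?_
    refine mul_le_of_le_one_left (hH0 t ⟨ht.1, ht.2.le⟩) ?_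
    rw [hE, Real.exp_le_one_iff, neg_nonpos]
    exact mul_nonneg hν0.le ht.1.le
  have h3 : ∫ t in (0 : ℝ)..S, D t ≤ Real.exp (ν * T) * ∫ t in (0 : ℝ)..S, E t * D t := by
    rw [← intervalIntegral.integral_const_mul]
    refine intervalIntegral.integral_mono_on_of_le_Ioo hS.1 hD (hED.const_mul _) fun t ht => ?_
    rw [← mul_assoc]
    refine le_mul_of_one_le_left (hD0 t ⟨ht.1, ht.2.le⟩) ?_
    rw [hE, ← Real.exp_add, Real.one_le_exp_iff]
    nlinarith [ht.2, hS.2]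
  have h4 : A * ((1 / ν) ^ α * ∫ t in (0 : ℝ)..S, E t * D t) ≤
      1 / 2 * ∫ t in (0 : ℝ)..S, E t * D t := by
    rw [← mul_assoc]; gcongr
  calc ∫ t in (0 : ℝ)..S, D t ≤ Real.exp (ν * T) * ∫ t in (0 : ℝ)..S, E t * D t := h3
    _ ≤ Real.exp (ν * T) * (2 * ∫ t in (0 : ℝ)..S, H t) := by
        gcongr; linarith
    _ = _ := by ring

/-! ### Solutions for a single mode: regularity -/

/-- The equation for a single mode: with `y = k_α * w`, `y' = g` and `w' = -λ b g + f`
on `(0, T]`. -/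
structure IsModeSolution (α T lam : ℝ) (b f w g : ℝ → ℝ) : Prop where
  cont_f : ContinuousOn f (Icc 0 T)
  cont_w : ContinuousOn w (Icc 0 T)
  deriv_y : ∀ t ∈ Ioc 0 T, HasDerivWithinAt (cv (rlKernel α) w) (g t) (Icc 0 T) t
  deriv_w : ∀ t ∈ Ioc 0 T, HasDerivWithinAt w (-(lam * b t * g t) + f t) (Icc 0 T) t

theorem abs_cv_rlKernel_le {α T K : ℝ} (hα : 0 < α) {w : ℝ → ℝ} (hK : ∀ s ∈ Icc 0 T, |w s| ≤ K)
    {t : ℝ} (ht : t ∈ Icc 0 T) : |cv (rlKernel α) w t| ≤ K * rlKernel (α + 1) t := by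
  rcases ht.1.eq_or_lt with h0 | h0
  · rw [← h0, cv, intervalIntegral.integral_same, rlKernel, add_sub_cancel_right,
      Real.zero_rpow hα.ne']
    simp
  rw [cv, ← integral_rlKernel hα h0, ← intervalIntegral.integral_const_mul, ← Real.norm_eq_abs]
  refine intervalIntegral.norm_integral_le_of_norm_le ht.1 (Filter.Eventually.of_forall
    fun s hs => ?_) ((intervalIntegrable_rlKernel hα 0 t).const_mul K)
  rw [norm_mul, Real.norm_of_nonneg (rlKernel_pos hα hs.1).le, mul_comm, Real.norm_eq_abs]
  exact mul_le_mul_of_nonneg_right (hK _ ⟨by linarith [hs.2], by linarith [hs.1, ht.2]⟩)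
    (rlKernel_pos hα hs.1).le

theorem rlKernel_succ_mono {α s t : ℝ} (hα : 0 < α) (hs : 0 ≤ s) (hst : s ≤ t) :
    rlKernel (α + 1) s ≤ rlKernel (α + 1) t := by
  rw [rlKernel, rlKernel, add_sub_cancel_right]
  exact div_le_div_of_nonneg_right (Real.rpow_le_rpow hs hst hα.le)
    (Real.Gamma_pos_of_pos (by linarith)).le

/-- No derivative is available at `0`; there the bound `|y| ≤ K k_{α+1}`, which vanishes at `0`,
takes over. -/
theorem IsModeSolution.continuousOn_y {α T lam : ℝ} {b f w g : ℝ → ℝ} (hα : 0 < α)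
    (h : IsModeSolution α T lam b f w g) : ContinuousOn (cv (rlKernel α) w) (Icc 0 T) := by
  intro t ht
  rcases ht.1.eq_or_lt with h0 | h0
  · obtain ⟨K, hK⟩ := isCompact_Icc.exists_bound_of_continuousOn h.cont_w
    subst h0
    have hy0 : cv (rlKernel α) w 0 = 0 := by simp [cv]
    rw [ContinuousWithinAt, hy0]
    have hlim : Filter.Tendsto (fun t => K * rlKernel (α + 1) t) (nhdsWithin 0 (Icc 0 T))
        (nhds 0) := by
      have hc : Continuous fun t : ℝ => K * rlKernel (α + 1) t := by
        simp only [rlKernel, add_sub_cancel_right]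
        exact continuous_const.mul ((Real.continuous_rpow_const hα.le).div_const _)
      have := (hc.tendsto 0).mono_left (nhdsWithin_le_nhds (s := Icc 0 T))
      simpa [rlKernel, Real.zero_rpow hα.ne'] using this
    refine squeeze_zero_norm' ?_ hlim
    filter_upwards [self_mem_nhdsWithin] with s hs
    exact abs_cv_rlKernel_le hα hK hs
  · exact (h.deriv_y t ⟨h0, ht.2⟩).continuousWithinAt

theorem continuousOn_of_abs_sub_le {b : ℝ → ℝ} {S : Set ℝ} {L : ℝ}
    (hb : ∀ t ∈ S, ∀ s ∈ S, |b t - b s| ≤ L * |t - s|) : ContinuousOn b S := by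
  intro x hx
  refine tendsto_iff_norm_sub_tendsto_zero.2 ?_
  have hlim : Filter.Tendsto (fun z => L * |z - x|) (nhdsWithin x S) (nhds 0) := by
    have hc : Continuous fun z : ℝ => L * |z - x| := by fun_prop
    have := (hc.tendsto x).mono_left (nhdsWithin_le_nhds (s := S))
    simpa using this
  refine squeeze_zero' (Filter.Eventually.of_forall fun z => norm_nonneg _) ?_ hlim
  filter_upwards [self_mem_nhdsWithin] with z hz using hb z hz x hx

/-- `w + λ b y` is Lipschitz on `(0, T]`, although `g = y'` may be unbounded. -/
theorem IsModeSolution.lipschitz {α T lam L F Y : ℝ} {b f w g : ℝ → ℝ} (hα : 0 < α)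
    (hlam : 0 ≤ lam) (h : IsModeSolution α T lam b f w g)
    (hbL : ∀ t ∈ Icc 0 T, ∀ s ∈ Icc 0 T, |b t - b s| ≤ L * |t - s|)
    (hF : ∀ t ∈ Icc 0 T, |f t| ≤ F) (hY : ∀ t ∈ Icc 0 T, |cv (rlKernel α) w t| ≤ Y)
    {s t : ℝ} (hs : 0 < s) (hst : s ≤ t) (ht : t ≤ T) :
    |(w t + lam * b t * cv (rlKernel α) w t) - (w s + lam * b s * cv (rlKernel α) w s)| ≤
      (F + lam * L * Y + 1) * (t - s) := by
  set y := cv (rlKernel α) w with hy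
  have hbc := continuousOn_of_abs_sub_le hbL
  set z : ℝ → ℝ := fun r => w r + lam * b r * y r with hz
  have hsub : Icc s t ⊆ Icc 0 T := Icc_subset_Icc hs.le ht
  have hzc : ContinuousOn (fun r => z r - z s) (Icc s t) :=
    ((h.cont_w.add ((continuousOn_const.mul hbc).mul (h.continuousOn_y hα))).mono hsub).sub
      continuousOn_const
  -- As `b` is only Lipschitz, `z` need not be differentiable, and the mean value inequality for
  -- right difference quotients is used. It asks for a strict inequality of slopes, hence the `+ 1`.
  have := image_norm_le_of_liminf_right_slope_norm_lt_deriv_boundary (f := fun r => z r - z s)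
    (f' := fun _ => F + lam * L * Y) (a := s) (b := t) hzc ?_
    (B := fun r => (F + lam * L * Y + 1) * (r - s)) (B' := fun _ => F + lam * L * Y + 1)
    (by simp) (by fun_prop) ?_ (fun x _ _ => by linarith) (right_mem_Icc.2 hst)
  · exact this
  · intro x hx r hr
    refine Filter.Eventually.frequently ?_
    have hx0 : 0 < x := hs.trans_le hx.1
    have hxT : x < T := hx.2.trans_le ht
    have hxI : x ∈ Icc 0 T := ⟨hx0.le, hxT.le⟩
    -- With `b` frozen at `x` the two terms in `g` cancel, so a possible blow-up of `g` does no
    -- harm.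
    have hd : HasDerivWithinAt (fun q => w q + lam * b x * y q) (f x) (Icc 0 T) x := by
      have := (h.deriv_w x ⟨hx0, hxT.le⟩).add ((h.deriv_y x ⟨hx0, hxT.le⟩).const_mul (lam * b x))
      convert! this using 1
      ring
    have hrF : ‖f x‖ < r - lam * L * Y := by
      have := hF x hxI
      rw [Real.norm_eq_abs]; linarith
    have hev := (hd.mono (Icc_subset_Icc_left hx0.le)).limsup_norm_slope_le hrF
    have hle : nhdsWithin x (Ioi x) ≤ nhdsWithin x (Icc x T) :=
      nhdsWithin_le_of_mem (by
        filter_upwards [Ioo_mem_nhdsGT hxT] with q hq using ⟨hq.1.le, hq.2.le⟩)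
    filter_upwards [hle hev, Ioo_mem_nhdsGT hxT] with q hq hqI
    have hqx : 0 < q - x := sub_pos.2 hqI.1
    have hqT : q ∈ Icc 0 T := ⟨(hx0.trans hqI.1).le, hqI.2.le⟩
    rw [Real.norm_of_nonneg hqx.le, inv_mul_lt_iff₀ hqx] at hq
    rw [slope_def_field, div_lt_iff₀ hqx]
    have e1 : z q - z x = ((w q + lam * b x * y q) - (w x + lam * b x * y x)) +
        lam * (b q - b x) * y q := by simp only [hz]; ring
    have e2 : |lam * (b q - b x) * y q| ≤ lam * L * Y * (q - x) := by
      rw [abs_mul, abs_mul, abs_of_nonneg hlam]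
      have := hbL q hqT x hxI
      rw [abs_of_pos hqx] at this
      calc lam * |b q - b x| * |y q| ≤ lam * (L * (q - x)) * Y := by
            have hY' := hY q hqT
            have : 0 ≤ L * (q - x) := (abs_nonneg _).trans this
            gcongr
        _ = _ := by ring
    have e3 : ‖z q - z s‖ - ‖z x - z s‖ ≤ |z q - z x| := by
      have := norm_sub_norm_le (z q - z s) (z x - z s)
      rwa [sub_sub_sub_cancel_right] at this
    have e4 : |z q - z x| ≤ |(w q + lam * b x * y q) - (w x + lam * b x * y x)| +
        |lam * (b q - b x) * y q| := by rw [e1]; exact abs_add_le _ _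
    rw [Real.norm_eq_abs] at hq
    simp only [Function.comp]
    linarith
  · intro x _
    have := ((hasDerivAt_id x).sub_const s).const_mul (F + lam * L * Y + 1)
    simpa using this.hasDerivWithinAt

theorem intervalIntegrable_rlKernel_mul_comp {α T t r : ℝ} (hα : 0 < α) {w : ℝ → ℝ}
    (hw : ContinuousOn w (Icc 0 T)) {s : ℝ} (hst : s ≤ t) (htr : t ≤ r)
    (hr : r - s ≤ T) :
    IntervalIntegrable (fun q => rlKernel α q * w (r - q)) volume s t := by
  refine (intervalIntegrable_rlKernel hα s t).mul_continuousOn ?_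
  refine hw.comp (by fun_prop) fun q hq => ?_
  rw [uIcc_of_le hst] at hq
  exact ⟨by linarith [hq.2], by linarith [hq.1]⟩

/-- With the shift placed on `w`, only the piece over `[t, t + h]` is left over; the kernel is at
most `k(t)` there, and `k` is integrable in `t`. -/
theorem abs_cv_rlKernel_add_sub_le {α T K : ℝ} (hα : 0 < α) (hα1 : α ≤ 1) {w : ℝ → ℝ}
    (hw : ContinuousOn w (Icc 0 T))
    (hK : ∀ s ∈ Icc 0 T, |w s| ≤ K) {t h : ℝ} (ht : 0 < t) (hh : 0 < h) (hth : t + h ≤ T) :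
    |cv (rlKernel α) w (t + h) - cv (rlKernel α) w t| ≤
      cv (rlKernel α) (fun s => |w (s + h) - w s|) t + K * (h * rlKernel α t) := by
  have hI1 := intervalIntegrable_rlKernel_mul_comp (r := t + h) (t := t) (s := 0) hα hw ht.le
    (by linarith) (by linarith)
  have hI2 := intervalIntegrable_rlKernel_mul_comp (r := t + h) (t := t + h) (s := t) hα hw
    (by linarith) le_rfl (by linarith)
  have hI3 := intervalIntegrable_rlKernel_mul_comp (r := t) (t := t) (s := 0) hα hw ht.le
    le_rfl (by linarith)
  have e : cv (rlKernel α) w (t + h) - cv (rlKernel α) w t =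
      (∫ s in (0 : ℝ)..t, rlKernel α s * (w (t - s + h) - w (t - s))) +
        ∫ s in t..(t + h), rlKernel α s * w (t + h - s) := by
    rw [cv, cv, ← intervalIntegral.integral_add_adjacent_intervals hI1 hI2, add_sub_right_comm,
      ← intervalIntegral.integral_sub hI1 hI3]
    congr 1
    refine intervalIntegral.integral_congr fun s _ => ?_
    rw [show t - s + h = t + h - s by ring]; ring
  have b1 : |∫ s in (0 : ℝ)..t, rlKernel α s * (w (t - s + h) - w (t - s))| ≤
      cv (rlKernel α) (fun s => |w (s + h) - w s|) t := by
    rw [cv, ← Real.norm_eq_abs]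
    refine (intervalIntegral.norm_integral_le_integral_norm ht.le).trans (le_of_eq ?_)
    refine intervalIntegral.integral_congr_ae (Filter.Eventually.of_forall fun s hs => ?_)
    rw [uIoc_of_le ht.le] at hs
    rw [norm_mul, Real.norm_of_nonneg (rlKernel_pos hα hs.1).le, Real.norm_eq_abs]
  have b2 : |∫ s in t..(t + h), rlKernel α s * w (t + h - s)| ≤ K * (h * rlKernel α t) := by
    rw [← Real.norm_eq_abs]
    refine (intervalIntegral.norm_integral_le_of_norm_le_const (C := rlKernel α t * K)
      fun s hs => ?_).trans (le_of_eq ?_)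
    · rw [uIoc_of_le (by linarith)] at hs
      rw [norm_mul, Real.norm_of_nonneg (rlKernel_pos hα (ht.trans hs.1)).le, Real.norm_eq_abs]
      have h1 := hK (t + h - s) ⟨by linarith [hs.2], by linarith [hs.1]⟩
      have h2 := rlKernel_anti hα hα1 ht hs.1.le
      have h3 := rlKernel_pos hα ht
      gcongr
    · rw [add_sub_cancel_left, abs_of_pos hh]; ring
  rw [e]
  exact (abs_add_le _ _).trans (add_le_add b1 b2)

/-- The difference quotients of `y` are bounded in `L¹`. -/
theorem IsModeSolution.integral_sub_le {α T lam L B : ℝ} {b f w g : ℝ → ℝ} (hα : 0 < α)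
    (hα1 : α ≤ 1) (hT : 0 < T) (hlam : 0 ≤ lam) (h : IsModeSolution α T lam b f w g)
    (hb : ∀ t ∈ Icc 0 T, |b t| ≤ B)
    (hbL : ∀ t ∈ Icc 0 T, ∀ s ∈ Icc 0 T, |b t - b s| ≤ L * |t - s|) :
    ∃ C : ℝ, ∀ δ ∈ Ioo 0 T, ∫ t in (0 : ℝ)..(T - δ),
      |cv (rlKernel α) w (t + δ) - cv (rlKernel α) w t| ≤ C * δ := by
  obtain ⟨F, hF⟩ := isCompact_Icc.exists_bound_of_continuousOn h.cont_f
  obtain ⟨K, hK⟩ := isCompact_Icc.exists_bound_of_continuousOn h.cont_w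
  have hyc := h.continuousOn_y hα
  obtain ⟨Y, hY⟩ := isCompact_Icc.exists_bound_of_continuousOn hyc
  simp only [Real.norm_eq_abs] at hF hK hY
  have h0T : (0 : ℝ) ∈ Icc 0 T := ⟨le_rfl, hT.le⟩
  have hF0 : 0 ≤ F := (abs_nonneg _).trans (hF 0 h0T)
  have hK0 : 0 ≤ K := (abs_nonneg _).trans (hK 0 h0T)
  have hY0 : 0 ≤ Y := (abs_nonneg _).trans (hY 0 h0T)
  have hB0 : 0 ≤ B := (abs_nonneg _).trans (hb 0 h0T)
  have hL0 : 0 ≤ L := by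
    have := (abs_nonneg _).trans (hbL T ⟨hT.le, le_rfl⟩ 0 h0T)
    rw [sub_zero, abs_of_pos hT] at this
    exact nonneg_of_mul_nonneg_left this hT
  set y := cv (rlKernel α) w with hy
  obtain ⟨C, hC0, hC⟩ := fractional_gronwall_integral (T := T) (A := lam * B) hα
    (mul_nonneg hlam hB0)
  set C₁ := F + lam * L * Y + 1 + lam * L * Y with hC₁
  set κ := rlKernel (α + 1) T with hκ
  have hC₁0 : 0 ≤ C₁ := by positivity
  set C₂ := C * (C₁ * T + lam * B * K * κ) with hC₂
  have hκ0 : 0 < κ := rlKernel_pos (by linarith) hT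
  refine ⟨κ * C₂ + K * κ, fun δ hδ => ?_⟩
  have hS0 : 0 < T - δ := by linarith [hδ.2]
  have hSI : Icc 0 (T - δ) ⊆ Icc 0 T := Icc_subset_Icc_right (by linarith [hδ.1])
  have hmaps : MapsTo (fun t => t + δ) (Icc 0 (T - δ)) (Icc 0 T) := fun t ht =>
    ⟨by linarith [ht.1, hδ.1], by linarith [ht.2]⟩
  set D : ℝ → ℝ := fun s => |w (s + δ) - w s| with hD
  have hDc : ContinuousOn D (Icc 0 (T - δ)) :=
    ((h.cont_w.comp (by fun_prop) hmaps).sub (h.cont_w.mono hSI)).abs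
  have hDi : IntervalIntegrable D volume 0 (T - δ) :=
    ContinuousOn.intervalIntegrable (by rwa [uIcc_of_le hS0.le])
  have hk := intervalIntegrable_rlKernel hα 0 (T - δ)
  have hκ' : ∫ t in (0 : ℝ)..(T - δ), rlKernel α t ≤ κ := by
    rw [integral_rlKernel hα hS0]
    exact rlKernel_succ_mono hα hS0.le (by linarith [hδ.1])
  have hdiff : ∀ t ∈ Ioo 0 (T - δ), |y (t + δ) - y t| ≤
      cv (rlKernel α) D t + K * (δ * rlKernel α t) := fun t ht =>
    abs_cv_rlKernel_add_sub_le hα hα1 h.cont_w hK ht.1 hδ.1 (by linarith [ht.2])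
  have hDle : ∀ t ∈ Ioo 0 (T - δ), D t ≤ lam * B * cv (rlKernel α) D t +
      (δ * C₁ + lam * B * K * δ * rlKernel α t) := by
    intro t ht
    have ht1 : t + δ ∈ Icc 0 T := hmaps ⟨ht.1.le, ht.2.le⟩
    have ht2 : t ∈ Icc 0 T := hSI ⟨ht.1.le, ht.2.le⟩
    have h1 := h.lipschitz hα hlam hbL hF hY ht.1 (by linarith [hδ.1] : t ≤ t + δ) ht1.2
    rw [add_sub_cancel_left] at h1
    have h2 := hbL _ ht1 _ ht2
    rw [add_sub_cancel_left, abs_of_pos hδ.1] at h2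
    -- The first two parts are `O(δ)`; the third returns to the increments of `w` through `hdiff`,
    -- which closes a fractional Gronwall inequality for `D`.
    have e1 : w (t + δ) - w t = ((w (t + δ) + lam * b (t + δ) * y (t + δ)) -
        (w t + lam * b t * y t)) - lam * (b (t + δ) - b t) * y (t + δ) -
        lam * b t * (y (t + δ) - y t) := by ring
    have h3 : |lam * (b (t + δ) - b t) * y (t + δ)| ≤ lam * L * Y * δ := by
      rw [abs_mul, abs_mul, abs_of_nonneg hlam]
      have := hY _ ht1
      have : 0 ≤ L * δ := mul_nonneg hL0 hδ.1.le
      calc lam * |b (t + δ) - b t| * |y (t + δ)| ≤ lam * (L * δ) * Y := by gcongr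
        _ = _ := by ring
    have h4 : |lam * b t * (y (t + δ) - y t)| ≤
        lam * B * (cv (rlKernel α) D t + K * (δ * rlKernel α t)) := by
      rw [abs_mul, abs_mul, abs_of_nonneg hlam]
      have h5 := hdiff t ht
      have := hb t ht2
      gcongr
    have h6 : D t ≤ (F + lam * L * Y + 1) * δ + lam * L * Y * δ +
        lam * B * (cv (rlKernel α) D t + K * (δ * rlKernel α t)) := by
      simp only [hD]
      rw [e1]
      refine (abs_sub _ _).trans (add_le_add ((abs_sub _ _).trans (add_le_add h1 h3)) h4)
    calc D t ≤ _ := h6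
      _ = _ := by rw [hC₁]; ring
  have hH0 : ∀ t ∈ Ioc 0 (T - δ), 0 ≤ δ * C₁ + lam * B * K * δ * rlKernel α t := fun t ht => by
    have := rlKernel_pos hα ht.1
    have := hδ.1
    positivity
  have hDint := hC (T - δ) ⟨hS0.le, by linarith [hδ.1]⟩ D _ hDi
    (intervalIntegrable_const.add (hk.const_mul _)) (fun _ _ => abs_nonneg _) hH0 hDle
  rw [intervalIntegral.integral_add intervalIntegrable_const (hk.const_mul _),
    intervalIntegral.integral_const, intervalIntegral.integral_const_mul, sub_zero,
    smul_eq_mul] at hDint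
  have hDint' : ∫ t in (0 : ℝ)..(T - δ), D t ≤ C₂ * δ := by
    refine hDint.trans ?_
    have := hδ.1
    calc C * ((T - δ) * (δ * C₁) + lam * B * K * δ * ∫ t in (0 : ℝ)..(T - δ), rlKernel α t)
        ≤ C * (T * (δ * C₁) + lam * B * K * δ * κ) := by gcongr; linarith
      _ = _ := by rw [hC₂]; ring
  have hyi : IntervalIntegrable (fun t => |y (t + δ) - y t|) volume 0 (T - δ) := by
    refine ContinuousOn.intervalIntegrable ?_
    rw [uIcc_of_le hS0.le]
    exact ((hyc.comp (by fun_prop) hmaps).sub (hyc.mono hSI)).abs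
  have hcv := intervalIntegrable_cv hS0.le hk hDi
  have hD0 : 0 ≤ ∫ t in (0 : ℝ)..(T - δ), D t :=
    intervalIntegral.integral_nonneg hS0.le fun _ _ => abs_nonneg _
  calc ∫ t in (0 : ℝ)..(T - δ), |y (t + δ) - y t|
      ≤ ∫ t in (0 : ℝ)..(T - δ), (cv (rlKernel α) D t + K * δ * rlKernel α t) := by
        refine intervalIntegral.integral_mono_on_of_le_Ioo hS0.le hyi
          (hcv.add (hk.const_mul _)) fun t ht => ?_
        rw [mul_assoc]; exact hdiff t ht
    _ = (∫ t in (0 : ℝ)..(T - δ), cv (rlKernel α) D t) +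
          K * δ * ∫ t in (0 : ℝ)..(T - δ), rlKernel α t := by
        rw [intervalIntegral.integral_add hcv (hk.const_mul _),
          intervalIntegral.integral_const_mul]
    _ ≤ κ * (C₂ * δ) + K * δ * κ := by
        have := hδ.1
        have h1 := integral_cv_le hS0.le hk hDi (fun s hs => (rlKernel_pos hα hs.1).le)
          fun _ _ => abs_nonneg _
        have h2 : (∫ t in (0 : ℝ)..(T - δ), rlKernel α t) * ∫ t in (0 : ℝ)..(T - δ), D t ≤
            κ * (C₂ * δ) := by gcongr
        have h3 : K * δ * ∫ t in (0 : ℝ)..(T - δ), rlKernel α t ≤ K * δ * κ := by gcongr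
        linarith
    _ = _ := by ring

/-- Fatou's lemma applied to the difference quotients of `y`. The bound obtained depends on `λ`, but
later only the finiteness of `∫ |g|` is used. -/
theorem IsModeSolution.intervalIntegrable {α T lam L B : ℝ} {b f w g : ℝ → ℝ} (hα : 0 < α)
    (hα1 : α ≤ 1) (hT : 0 < T) (hlam : 0 ≤ lam) (h : IsModeSolution α T lam b f w g)
    (hb : ∀ t ∈ Icc 0 T, |b t| ≤ B)
    (hbL : ∀ t ∈ Icc 0 T, ∀ s ∈ Icc 0 T, |b t - b s| ≤ L * |t - s|) :
    IntervalIntegrable g volume 0 T := by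
  obtain ⟨C, hC⟩ := h.integral_sub_le hα hα1 hT hlam hb hbL
  have hyc := h.continuousOn_y hα
  set y := cv (rlKernel α) w with hy
  -- The shift by `2` keeps `δ n < T` already for `n = 0`.
  set δ : ℕ → ℝ := fun n => T / (n + 2) with hδ
  have hδI : ∀ n, δ n ∈ Ioo 0 T := fun n => ⟨by positivity, by
    rw [hδ, div_lt_iff₀ (by positivity)]; nlinarith⟩
  have hδ0 : Filter.Tendsto δ Filter.atTop (nhds 0) :=
    tendsto_const_nhds.div_atTop
      (Filter.tendsto_atTop_add_const_right _ _ tendsto_natCast_atTop_atTop)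
  set q : ℕ → ℝ → ℝ := fun n => (Ioo 0 (T - δ n)).indicator
    fun t => (δ n)⁻¹ * (y (t + δ n) - y t) with hq
  have hqc : ∀ n, ContinuousOn (fun t => (δ n)⁻¹ * (y (t + δ n) - y t)) (Icc 0 (T - δ n)) :=
    fun n => continuousOn_const.mul ((hyc.comp (by fun_prop) fun t ht =>
      ⟨by linarith [ht.1, (hδI n).1], by linarith [ht.2]⟩).sub
        (hyc.mono (Icc_subset_Icc_right (by linarith [(hδI n).1]))))
  have hqi : ∀ n, Integrable (q n) (volume.restrict (Ioo 0 T)) := fun n =>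
    ((integrable_indicator_iff measurableSet_Ioo).2
      (((hqc n).integrableOn_Icc).mono_set Ioo_subset_Icc_self)).restrict
  have hlim : ∀ᵐ t ∂volume.restrict (Ioo 0 T),
      Filter.Tendsto (fun n => q n t) Filter.atTop (nhds (g t)) := by
    refine (ae_restrict_iff' measurableSet_Ioo).2 (Filter.Eventually.of_forall fun t ht => ?_)
    have hd : HasDerivAt y (g t) t :=
      (h.deriv_y t ⟨ht.1, ht.2.le⟩).hasDerivAt (Icc_mem_nhds ht.1 ht.2)
    have h1 := (hasDerivAt_iff_tendsto_slope_zero.1 hd).comp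
      (tendsto_nhdsWithin_iff.2 ⟨hδ0, Filter.Eventually.of_forall fun n => (hδI n).1.ne'⟩)
    refine h1.congr' ?_
    have h2 : ∀ᶠ n in Filter.atTop, δ n < T - t :=
      hδ0.eventually (gt_mem_nhds (by linarith [ht.2]))
    filter_upwards [h2] with n hn
    simp only [hq, Function.comp]
    rw [indicator_of_mem (show t ∈ Ioo 0 (T - δ n) from ⟨ht.1, by linarith⟩), smul_eq_mul]
  have hnorm : ∀ n, eLpNorm (q n) 1 (volume.restrict (Ioo 0 T)) ≤ ENNReal.ofReal C := by
    intro n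
    rw [eLpNorm_one_eq_lintegral_enorm, ← ofReal_integral_norm_eq_lintegral_enorm (hqi n)]
    refine ENNReal.ofReal_le_ofReal ?_
    have hS0 : 0 ≤ T - δ n := by linarith [(hδI n).2]
    have e1 : ∀ t, ‖q n t‖ = (Ioo 0 (T - δ n)).indicator
        (fun t => (δ n)⁻¹ * |y (t + δ n) - y t|) t := fun t => by
      rw [hq, norm_indicator_eq_indicator_norm]
      congr 1; funext t
      rw [norm_mul, Real.norm_of_nonneg (inv_nonneg.2 (hδI n).1.le), Real.norm_eq_abs]
    simp only [e1]
    rw [setIntegral_indicator measurableSet_Ioo,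
      inter_eq_self_of_subset_right (Ioo_subset_Ioo_right (by linarith [(hδI n).1])),
      integral_const_mul, ← integral_Ioc_eq_integral_Ioo, ← intervalIntegral.integral_of_le hS0,
      inv_mul_le_iff₀ (hδI n).1, mul_comm]
    exact hC _ (hδI n)
  have hfin : eLpNorm g 1 (volume.restrict (Ioo 0 T)) ≤ ENNReal.ofReal C :=
    (Lp.eLpNorm_lim_le_liminf_eLpNorm (fun n => (hqi n).aestronglyMeasurable) g hlim).trans
      (Filter.liminf_le_of_frequently_le' (Filter.Frequently.of_forall hnorm))
  rw [intervalIntegrable_iff_integrableOn_Ioo_of_le hT.le, IntegrableOn, ← memLp_one_iff_integrable]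
  exact ⟨aestronglyMeasurable_of_tendsto_ae Filter.atTop
    (fun n => (hqi n).aestronglyMeasurable) hlim, hfin.trans_lt ENNReal.ofReal_lt_top⟩

/-! ### Solutions for a single mode: estimates -/

theorem uIcc_subset_of_mem {T t : ℝ} (ht : t ∈ Icc 0 T) : uIcc 0 t ⊆ uIcc 0 T := by
  rw [uIcc_of_le ht.1, uIcc_of_le (ht.1.trans ht.2)]
  exact Icc_subset_Icc_right ht.2

theorem integral_eq_sub_of_hasDerivWithinAt_Ioc {T : ℝ} {u u' : ℝ → ℝ}
    (hu : ContinuousOn u (Icc 0 T)) (hd : ∀ t ∈ Ioc 0 T, HasDerivWithinAt u (u' t) (Icc 0 T) t)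
    (hi : IntervalIntegrable u' volume 0 T) {t : ℝ} (ht : t ∈ Icc 0 T) :
    ∫ s in (0 : ℝ)..t, u' s = u t - u 0 := by
  refine intervalIntegral.integral_eq_sub_of_hasDerivAt_of_le ht.1
    (hu.mono (Icc_subset_Icc_right ht.2)) (fun s hs => ?_) (hi.mono_set (uIcc_subset_of_mem ht))
  have hs' : s < T := hs.2.trans_le ht.2
  exact (hd s ⟨hs.1, hs'.le⟩).hasDerivAt (Icc_mem_nhds hs.1 hs')

/-- Representation of `y` by the resolvent for the coefficient frozen at a fixed time. -/
theorem IsModeSolution.y_eq {α T lam : ℝ} {b f w g : ℝ → ℝ} (hα : 0 < α)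
    (h : IsModeSolution α T lam b f w g) (hbc : ContinuousOn b (Icc 0 T))
    (hg : IntervalIntegrable g volume 0 T) (b₀ : ℝ) {t : ℝ} (ht : t ∈ Icc 0 T) :
    cv (rlKernel α) w t = ∫ s in (0 : ℝ)..t, (w 0 * rlResolvent α (lam * b₀) s +
      cv (fun r => f r + lam * (b₀ - b r) * g r) (rlResolvent α (lam * b₀)) s) := by
  have hT : 0 ≤ T := ht.1.trans ht.2
  set μ := lam * b₀ with hμ
  set e := rlResolvent α μ with he
  set k := rlKernel α with hk
  set φ : ℝ → ℝ := fun r => f r + lam * (b₀ - b r) * g r with hφ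
  have hei : ∀ t, IntervalIntegrable e volume 0 t := intervalIntegrable_rlResolvent hα μ 0
  have hki : ∀ t, IntervalIntegrable k volume 0 t := intervalIntegrable_rlKernel hα 0
  have hfi : IntervalIntegrable f volume 0 T :=
    ContinuousOn.intervalIntegrable (by rw [uIcc_of_le hT]; exact h.cont_f)
  have hwi : IntervalIntegrable w volume 0 T :=
    ContinuousOn.intervalIntegrable (by rw [uIcc_of_le hT]; exact h.cont_w)
  have hφi : IntervalIntegrable φ volume 0 T := hfi.add (hg.continuousOn_mul
    (g := fun r => lam * (b₀ - b r)) (by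
      rw [uIcc_of_le hT]; exact continuousOn_const.mul (continuousOn_const.sub hbc)))
  have hyc := h.continuousOn_y hα
  have hy0 : cv k w 0 = 0 := by simp [cv]
  -- The equation with frozen coefficient, integrated in time. Convolving it with `e` produces `y`
  -- on the left, by the resolvent equation.
  have hF : ∀ s ∈ Icc 0 T, w s + μ * cv k w s = w 0 + cv (fun _ => 1) φ s := by
    intro s hs
    rw [cv_one, integral_eq_sub_of_hasDerivWithinAt_Ioc (u := fun s => w s + μ * cv k w s)
      (h.cont_w.add (continuousOn_const.mul hyc)) (fun r hr => ?_) hφi hs, hy0]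
    · ring
    · convert! (h.deriv_w r hr).add ((h.deriv_y r hr).const_mul μ) using 1
      simp only [hφ, hμ]; ring
  obtain ⟨K, hK⟩ := isCompact_Icc.exists_bound_of_continuousOn h.cont_w
  obtain ⟨Y, hY⟩ := isCompact_Icc.exists_bound_of_continuousOn hyc
  simp only [Real.norm_eq_abs] at hK hY
  have hIoc : ∀ s ∈ Ioc 0 T, s ∈ Icc 0 T := fun s hs => ⟨hs.1.le, hs.2⟩
  have hyi : IntervalIntegrable (cv k w) volume 0 T :=
    ContinuousOn.intervalIntegrable (by rw [uIcc_of_le hT]; exact hyc)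
  -- `e * (w + μ y) = (e + μ e * k) * w = y`
  have h1 : cv e (fun s => w s + μ * cv k w s) t = cv k w t := by
    have i1 := intervalIntegrable_cv_integrand ht.1 ht.2 (hei T) hwi fun s hs => hK s (hIoc s hs)
    have i2 := intervalIntegrable_cv_integrand ht.1 ht.2 (hei T) hyi fun s hs => hY s (hIoc s hs)
    have i3 := intervalIntegrable_cv_integrand ht.1 ht.2 (intervalIntegrable_cv hT (hki T) (hei T))
      hwi fun s hs => hK s (hIoc s hs)
    have e1 : cv e (cv k w) t = cv (cv k e) w t := by
      rw [cv_comm, cv_comm (cv k e), ← cv_assoc ht.1 ht.2 hwi (hki T) (hei T)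
        fun s hs => hK s (hIoc s hs)]
      exact cv_congr ht.1 (fun s _ => cv_comm _ _ _) fun _ _ => rfl
    calc cv e (fun s => w s + μ * cv k w s) t = cv e w t + μ * cv e (cv k w) t := by
          rw [cv, cv, cv, ← intervalIntegral.integral_const_mul,
            ← intervalIntegral.integral_add i1 (i2.const_mul μ)]
          refine intervalIntegral.integral_congr fun s _ => ?_
          ring
      _ = cv e w t + μ * cv (cv k e) w t := by rw [e1]
      _ = cv (fun s => e s + μ * cv k e s) w t := by
          rw [cv, cv, cv, ← intervalIntegral.integral_const_mul,
            ← intervalIntegral.integral_add i1 (i3.const_mul μ)]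
          refine intervalIntegral.integral_congr fun s _ => ?_
          ring
      _ = cv k w t := cv_congr ht.1 (fun s hs => rlResolvent_add hα μ hs.1) fun _ _ => rfl
  have hpc : ContinuousOn (cv (fun _ => 1) φ) (Icc 0 T) := by
    have : cv (fun _ => 1) φ = fun s => ∫ r in (0 : ℝ)..s, φ r := funext fun s => cv_one φ s
    rw [this]
    have := intervalIntegral.continuousOn_primitive_interval' (μ := volume) (a := 0) hφi
      left_mem_uIcc
    rwa [uIcc_of_le hT] at this
  obtain ⟨P, hP⟩ := isCompact_Icc.exists_bound_of_continuousOn hpc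
  have hpi : IntervalIntegrable (cv (fun _ => 1) φ) volume 0 T :=
    ContinuousOn.intervalIntegrable (by rw [uIcc_of_le hT]; exact hpc)
  have i4 := intervalIntegrable_cv_integrand ht.1 ht.2 (hei T) hpi fun s hs => hP s (hIoc s hs)
  have h2 : cv e (fun s => w 0 + cv (fun _ => 1) φ s) t =
      w 0 * (∫ s in (0 : ℝ)..t, e s) + cv e (cv (fun _ => 1) φ) t := by
    rw [cv, cv, ← intervalIntegral.integral_const_mul,
      ← intervalIntegral.integral_add ((hei t).const_mul (w 0)) i4]
    refine intervalIntegral.integral_congr fun s _ => ?_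
    ring
  have h3 : cv e (cv (fun _ => 1) φ) t = ∫ s in (0 : ℝ)..t, cv φ e s := by
    rw [cv_comm, cv_assoc ht.1 ht.2 (by simp) hφi (hei T) (C := 1) (by simp), cv_one]
  have hcvi : IntervalIntegrable (cv φ e) volume 0 t :=
    (intervalIntegrable_cv hT hφi (hei T)).mono_set (uIcc_subset_of_mem ht)
  rw [intervalIntegral.integral_add ((hei t).const_mul _) hcvi,
    intervalIntegral.integral_const_mul, ← h3, ← h2, ← h1]
  exact cv_congr ht.1 (fun _ _ => rfl) fun s hs => hF s ⟨hs.1.le, hs.2.le.trans ht.2⟩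

theorem ae_intervalIntegrable_cv_integrand {f g : ℝ → ℝ} {T : ℝ} (hT : 0 ≤ T)
    (hf : IntervalIntegrable f volume 0 T) (hg : IntervalIntegrable g volume 0 T) :
    ∀ᵐ t, t ∈ Ioc 0 T → IntervalIntegrable (fun s => f s * g (t - s)) volume 0 t := by
  filter_upwards [(integrable_indicator_of_intervalIntegrable hT hf).ae_convolution_exists
    (ContinuousLinearMap.mul ℝ ℝ) (integrable_indicator_of_intervalIntegrable hT hg)] with t ht htT
  rw [intervalIntegrable_iff_integrableOn_Ioo_of_le htT.1.le]
  refine (ht.integrableOn (s := Ioo 0 t)).congr_fun (fun s hs => ?_) measurableSet_Ioo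
  simp only [ContinuousLinearMap.mul_apply']
  rw [indicator_of_mem (show s ∈ Ioc 0 T from ⟨hs.1, hs.2.le.trans htT.2⟩),
    indicator_of_mem (show t - s ∈ Ioc 0 T from ⟨by linarith [hs.2], by linarith [hs.1, htT.2]⟩)]

/-- The coefficient is frozen at `t₀`. As `φ * e` is controlled only almost everywhere, `g(t₀)` is
bounded through the left difference quotients of `y`, that is, through averages over `(t, t₀)` as
`t` tends to `t₀`. -/
theorem IsModeSolution.abs_le_add_integral {α T lam L Φ : ℝ} {b f w g : ℝ → ℝ} (hα : 0 < α)
    (hα1 : α < 1) (hlam : 0 < lam) (h : IsModeSolution α T lam b f w g)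
    (hbL : ∀ t ∈ Icc 0 T, ∀ s ∈ Icc 0 T, |b t - b s| ≤ L * |t - s|) (hL : 0 ≤ L)
    (hg : IntervalIntegrable g volume 0 T) {t₀ : ℝ} (ht₀ : t₀ ∈ Ioc 0 T) (hb : 0 < b t₀)
    (hΦ : ∀ s ∈ Icc 0 t₀, |f s| ≤ Φ) :
    |g t₀| ≤ |w 0| * rlResolvent α (lam * b t₀) t₀ + Φ / (lam * b t₀) +
      L / b t₀ * ∫ s in (0 : ℝ)..t₀, |g s| := by
  have hT : 0 ≤ T := ht₀.1.le.trans ht₀.2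
  have hbc := continuousOn_of_abs_sub_le hbL
  set μ := lam * b t₀ with hμ
  have hμ0 : 0 < μ := mul_pos hlam hb
  set e := rlResolvent α μ with he
  set φ : ℝ → ℝ := fun r => f r + lam * (b t₀ - b r) * g r with hφ
  have ht₀I : t₀ ∈ Icc 0 T := ⟨ht₀.1.le, ht₀.2⟩
  have hΦ0 : 0 ≤ Φ := (abs_nonneg _).trans (hΦ 0 ⟨le_rfl, ht₀.1.le⟩)
  have hei : ∀ s t, IntervalIntegrable e volume s t := intervalIntegrable_rlResolvent hα μ
  have hep : ∀ s, 0 < s → 0 < e s := fun s hs => rlResolvent_pos hα hα1 hμ0 hs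
  have hfi : IntervalIntegrable f volume 0 T :=
    ContinuousOn.intervalIntegrable (by rw [uIcc_of_le hT]; exact h.cont_f)
  have hφi : IntervalIntegrable φ volume 0 T := hfi.add (hg.continuousOn_mul
    (g := fun r => lam * (b t₀ - b r)) (by
      rw [uIcc_of_le hT]; exact continuousOn_const.mul (continuousOn_const.sub hbc)))
  set J := ∫ s in (0 : ℝ)..t₀, |g s| with hJ
  have hgt : IntervalIntegrable (fun s => |g s|) volume 0 t₀ :=
    (hg.mono_set (uIcc_subset_of_mem ht₀I)).abs
  set Q := Φ / μ + L / b t₀ * J with hQ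
  set c : ℝ → ℝ := cv (fun r => |g r|) e with hc
  have hci : IntervalIntegrable c volume 0 T := intervalIntegrable_cv hT hg.abs (hei 0 T)
  have hcφ : IntervalIntegrable (cv φ e) volume 0 T := intervalIntegrable_cv hT hφi (hei 0 T)
  have hsub : ∀ t ∈ Ioo 0 t₀, uIcc t t₀ ⊆ uIcc 0 T := fun t ht => by
    rw [uIcc_of_le ht.2.le, uIcc_of_le hT]; exact Icc_subset_Icc ht.1.le ht₀.2
  -- pointwise bound of the convolution
  have hpt : ∀ t ∈ Ioo 0 t₀, ∀ᵐ s, s ∈ Ioc t t₀ → ‖w 0 * e s + cv φ e s‖ ≤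
      |w 0| * e s + Q + lam * L * (t₀ - t) * c s := by
    intro t ht
    filter_upwards [ae_intervalIntegrable_cv_integrand hT hg.abs (hei 0 T)] with s hsi hs
    have hs0 : 0 < s := ht.1.trans hs.1
    have hsT : s ≤ T := hs.2.trans ht₀.2
    replace hsi := hsi ⟨hs0, hsT⟩
    have hes : IntervalIntegrable (fun r => e (s - r)) volume 0 s := by
      simpa using ((hei 0 s).comp_sub_left s).symm
    have hgs : IntervalIntegrable (fun r => |g r|) volume 0 s :=
      hg.abs.mono_set (uIcc_subset_of_mem ⟨hs0.le, hsT⟩)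
    have b1 : ‖cv φ e s‖ ≤ ∫ r in (0 : ℝ)..s, (Φ * e (s - r) + lam * L / μ * |g r| +
        lam * L * (t₀ - t) * (|g r| * e (s - r))) := by
      refine intervalIntegral.norm_integral_le_of_norm_le hs0.le ?_
        (((hes.const_mul Φ).add (hgs.const_mul _)).add (hsi.const_mul _))
      have hne : ∀ᵐ r : ℝ, r ≠ s := by simp [ae_iff, measure_singleton]
      filter_upwards [hne] with r hrs hr
      have hrs : r < s := lt_of_le_of_ne hr.2 hrs
      have her := hep (s - r) (by linarith)
      have htr : 0 < t₀ - r := by linarith [hs.2]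
      have hrT : r ∈ Icc 0 T := ⟨hr.1.le, hr.2.trans hsT⟩
      have q1 : |φ r| ≤ Φ + lam * (L * (t₀ - r)) * |g r| := by
        refine (abs_add_le _ _).trans (add_le_add (hΦ r ⟨hr.1.le, hr.2.trans hs.2⟩) ?_)
        rw [abs_mul, abs_mul, abs_of_pos hlam]
        have := hbL t₀ ht₀I r hrT
        rw [abs_of_pos htr] at this
        gcongr
      -- Split `t₀ - r = (s - r) + (t₀ - s)`. The first part gains `1/μ` by `mul_rlResolvent_le`, as
      -- `α < 1`; the second leaves an error that vanishes as `t` tends to `t₀`.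
      have q2 : (t₀ - r) * e (s - r) ≤ 1 / μ + (t₀ - t) * e (s - r) := by
        have q3 := mul_rlResolvent_le hα hα1 hμ0 (sub_pos.2 hrs)
        have q4 : (s - r) * e (s - r) ≤ 1 / μ := by
          rw [le_div_iff₀ hμ0]; linarith
        have q5 : (t₀ - s) * e (s - r) ≤ (t₀ - t) * e (s - r) := by
          have := hs.1.le
          gcongr
        linarith
      rw [norm_mul, Real.norm_eq_abs, Real.norm_of_nonneg her.le]
      calc |φ r| * e (s - r) ≤ (Φ + lam * (L * (t₀ - r)) * |g r|) * e (s - r) := by gcongr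
        _ = Φ * e (s - r) + lam * L * |g r| * ((t₀ - r) * e (s - r)) := by ring
        _ ≤ Φ * e (s - r) + lam * L * |g r| * (1 / μ + (t₀ - t) * e (s - r)) := by gcongr
        _ = _ := by ring
    have b2 : (∫ r in (0 : ℝ)..s, (Φ * e (s - r) + lam * L / μ * |g r| +
        lam * L * (t₀ - t) * (|g r| * e (s - r)))) ≤ Q + lam * L * (t₀ - t) * c s := by
      rw [intervalIntegral.integral_add ((hes.const_mul Φ).add (hgs.const_mul _))
        (hsi.const_mul _), intervalIntegral.integral_add (hes.const_mul Φ) (hgs.const_mul _),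
        intervalIntegral.integral_const_mul, intervalIntegral.integral_const_mul,
        intervalIntegral.integral_const_mul]
      refine add_le_add (add_le_add ?_ ?_) le_rfl
      · have := intervalIntegral.integral_comp_sub_left e s (a := 0) (b := s)
        rw [this, sub_self, sub_zero, le_div_iff₀ hμ0]
        have := mul_integral_rlResolvent_le hα hα1 hμ0 hs0.le
        calc Φ * (∫ x in (0 : ℝ)..s, e x) * μ = Φ * (μ * ∫ x in (0 : ℝ)..s, e x) := by ring
          _ ≤ Φ * 1 := by gcongr
          _ = Φ := mul_one _
      -- Here `λ` cancels, so the Gronwall coefficient is uniform over the modes.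
      · have e1 : lam * L / μ = L / b t₀ := by rw [hμ]; field_simp
        rw [e1]
        refine mul_le_mul_of_nonneg_left ?_ (div_nonneg hL hb.le)
        exact intervalIntegral.integral_mono_interval le_rfl hs0.le hs.2
          (Filter.Eventually.of_forall fun _ => abs_nonneg _) hgt
    calc ‖w 0 * e s + cv φ e s‖ ≤ ‖w 0 * e s‖ + ‖cv φ e s‖ := norm_add_le _ _
      _ ≤ |w 0| * e s + (Q + lam * L * (t₀ - t) * c s) := by
          rw [norm_mul, Real.norm_eq_abs, Real.norm_of_nonneg (hep s hs0).le]
          exact add_le_add le_rfl (b1.trans b2)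
      _ = _ := by ring
  have hslope : ∀ t ∈ Ioo 0 t₀, |slope (cv (rlKernel α) w) t₀ t| ≤
      |w 0| * ((∫ s in t..t₀, e s) / (t₀ - t)) + Q + lam * L * ∫ s in t..t₀, c s := by
    intro t ht
    have htI : t ∈ Icc 0 T := ⟨ht.1.le, ht.2.le.trans ht₀.2⟩
    have hpos : 0 < t₀ - t := sub_pos.2 ht.2
    have hYi : IntervalIntegrable (fun s => w 0 * e s + cv φ e s) volume 0 T :=
      ((hei 0 T).const_mul _).add hcφ
    have e1 : cv (rlKernel α) w t₀ - cv (rlKernel α) w t =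
        ∫ s in t..t₀, (w 0 * e s + cv φ e s) := by
      rw [h.y_eq hα hbc hg (b t₀) ht₀I, h.y_eq hα hbc hg (b t₀) htI]
      exact intervalIntegral.integral_interval_sub_left
        (hYi.mono_set (uIcc_subset_of_mem ht₀I)) (hYi.mono_set (uIcc_subset_of_mem htI))
    have e2 : |cv (rlKernel α) w t₀ - cv (rlKernel α) w t| ≤
        |w 0| * (∫ s in t..t₀, e s) + (t₀ - t) * Q + lam * L * (t₀ - t) * ∫ s in t..t₀, c s := by
      have hci' := hci.mono_set (hsub t ht)
      rw [e1, ← Real.norm_eq_abs]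
      refine (intervalIntegral.norm_integral_le_of_norm_le ht.2.le (hpt t ht)
        ((((hei t t₀).const_mul _).add intervalIntegrable_const).add
          (hci'.const_mul _))).trans (le_of_eq ?_)
      rw [intervalIntegral.integral_add (((hei t t₀).const_mul _).add intervalIntegrable_const)
        (hci'.const_mul _), intervalIntegral.integral_add ((hei t t₀).const_mul _)
        intervalIntegrable_const, intervalIntegral.integral_const_mul,
        intervalIntegral.integral_const_mul, intervalIntegral.integral_const, smul_eq_mul]
    rw [slope_comm, slope_def_field, abs_div, abs_of_pos hpos, div_le_iff₀ hpos]
    refine e2.trans (le_of_eq ?_)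
    field_simp
  have hfil : Filter.NeBot (nhdsWithin t₀ (Iio t₀)) := inferInstance
  have hle : nhdsWithin t₀ (Iio t₀) ≤ nhdsWithin t₀ (Icc 0 T \ {t₀}) :=
    nhdsWithin_le_of_mem (by
      filter_upwards [Ioo_mem_nhdsLT ht₀.1] with s hs
      exact ⟨⟨hs.1.le, hs.2.le.trans ht₀.2⟩, ne_of_lt hs.2⟩)
  have l1 : Filter.Tendsto (fun t => |slope (cv (rlKernel α) w) t₀ t|) (nhdsWithin t₀ (Iio t₀))
      (nhds |g t₀|) :=
    ((hasDerivWithinAt_iff_tendsto_slope.1 (h.deriv_y t₀ ht₀)).mono_left hle).abs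
  have l2 : Filter.Tendsto (fun t => (∫ s in t..t₀, e s) / (t₀ - t)) (nhdsWithin t₀ (Iio t₀))
      (nhds (e t₀)) := by
    have hcont : ContinuousAt e t₀ :=
      (continuousOn_rlResolvent hα μ).continuousAt (Ioi_mem_nhds ht₀.1)
    have hmeas : StronglyMeasurableAtFilter e (nhds t₀) volume :=
      (continuousOn_rlResolvent hα μ).stronglyMeasurableAtFilter isOpen_Ioi t₀ ht₀.1
    have hd := intervalIntegral.integral_hasDerivAt_right (hei 0 t₀) hmeas hcont
    have := (hasDerivAt_iff_tendsto_slope.1 hd).mono_left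
      (nhdsWithin_mono t₀ (fun x hx => ne_of_lt hx : Iio t₀ ⊆ {t₀}ᶜ))
    refine this.congr' ?_
    filter_upwards [self_mem_nhdsWithin] with t ht
    rw [slope_comm, slope_def_field, intervalIntegral.integral_interval_sub_left (hei _ _)
      (hei _ _)]
  have l3 : Filter.Tendsto (fun t => ∫ s in t..t₀, c s) (nhdsWithin t₀ (Iio t₀)) (nhds 0) := by
    have hI2 : IntegrableOn c (uIcc 0 t₀) := by
      rw [uIcc_of_le ht₀.1.le, integrableOn_Icc_iff_integrableOn_Ioc]
      exact (intervalIntegrable_iff_integrableOn_Ioc_of_le ht₀.1.le).1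
        (hci.mono_set (uIcc_subset_of_mem ht₀I))
    have h1 := intervalIntegral.continuousOn_primitive_interval_left hI2
    have h2 := h1 t₀ right_mem_uIcc
    simp only [ContinuousWithinAt, intervalIntegral.integral_same] at h2
    refine h2.mono_left ?_
    rw [uIcc_of_le ht₀.1.le]
    refine nhdsWithin_le_of_mem ?_
    filter_upwards [Ioo_mem_nhdsLT ht₀.1] with s hs using ⟨hs.1.le, hs.2.le⟩
  have l4 := ((l2.const_mul |w 0|).add_const Q).add (l3.const_mul (lam * L))
  rw [mul_zero, add_zero] at l4
  have := le_of_tendsto_of_tendsto l1 l4 (by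
    filter_upwards [Ioo_mem_nhdsLT ht₀.1] with t ht using hslope t ht)
  rw [hQ] at this
  linarith

/-- The singularity `t^(β-1)` is integrable. Gronwall bounds the primitive of `u`, and inserting
that bound once into the hypothesis returns the same singularity pointwise, since `t^β / β ≤ (T / β)
t^(β-1)`. -/
theorem gronwall_singular {T β K : ℝ} (hT : 0 < T) (hβ : 0 < β) (hK : 0 < K) :
    ∃ C : ℝ, 0 < C ∧ ∀ (u Φ : ℝ → ℝ) (A : ℝ), 0 ≤ A → IntervalIntegrable u volume 0 T →
      (∀ t ∈ Ioc 0 T, 0 ≤ u t) → MonotoneOn Φ (Icc 0 T) → 0 ≤ Φ 0 →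
      (∀ t ∈ Ioc 0 T, u t ≤ A * t ^ (β - 1) + Φ t + K * ∫ s in (0 : ℝ)..t, u s) →
      ∀ t ∈ Ioc 0 T, u t ≤ C * (A * t ^ (β - 1) + Φ t) := by
  refine ⟨1 + K * Real.exp (K * T) * (T / β + T), by positivity,
    fun u Φ A hA hu hu0 hΦ hΦ0 hle t ht => ?_⟩
  have htI : t ∈ Icc 0 T := ⟨ht.1.le, ht.2⟩
  set v : ℝ → ℝ := (Ioc 0 T).indicator u with hv
  have hvi : Integrable v := integrable_indicator_of_intervalIntegrable hT.le hu
  have hv0 : ∀ s, 0 ≤ v s := fun s => indicator_nonneg hu0 s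
  have huv : ∀ s ∈ Icc 0 T, ∫ r in (0 : ℝ)..s, u r = ∫ r in (0 : ℝ)..s, v r := fun s hs => by
    refine intervalIntegral.integral_congr_ae (Filter.Eventually.of_forall fun r hr => ?_)
    rw [uIoc_of_le hs.1] at hr
    rw [hv, indicator_of_mem (show r ∈ Ioc 0 T from ⟨hr.1, hr.2.trans hs.2⟩)]
  set U : ℝ → ℝ := fun s => ∫ r in (0 : ℝ)..s, v r with hU
  have hUc : Continuous U := intervalIntegral.continuous_primitive
    (fun a b => hvi.intervalIntegrable) 0
  have hU0 : ∀ s, 0 ≤ s → 0 ≤ U s := fun s hs =>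
    intervalIntegral.integral_nonneg hs fun r _ => hv0 r
  -- As `u` is only integrable, its primitive `U` need not be differentiable. One more integration
  -- gives a `C¹` function with `V' = U ≤ K V + Ψ`.
  set V : ℝ → ℝ := fun s => ∫ r in (0 : ℝ)..s, U r with hV
  have hVd : ∀ s, HasDerivAt V (U s) s := fun s =>
    (hUc.integral_hasStrictDerivAt 0 s).hasDerivAt
  have hV0 : ∀ s, 0 ≤ s → 0 ≤ V s := fun s hs =>
    intervalIntegral.integral_nonneg hs fun r hr => hU0 r hr.1
  set Ψ := A * (t ^ β / β) + t * Φ t with hΨ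
  have hΦt : 0 ≤ Φ t := hΦ0.trans (hΦ ⟨le_rfl, hT.le⟩ htI ht.1.le)
  have hUV : ∀ s ∈ Icc 0 t, U s ≤ K * V s + Ψ := by
    intro s hs
    have hp : IntervalIntegrable (fun r : ℝ => r ^ (β - 1)) volume 0 s :=
      intervalIntegral.intervalIntegrable_rpow' (by linarith)
    have hi1 : IntervalIntegrable (fun r : ℝ => A * r ^ (β - 1) + Φ t) volume 0 s :=
      (hp.const_mul A).add intervalIntegrable_const
    have hi2 : IntervalIntegrable (fun r => K * U r) volume 0 s :=
      (hUc.intervalIntegrable 0 s).const_mul K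
    calc U s ≤ ∫ r in (0 : ℝ)..s, (A * r ^ (β - 1) + Φ t + K * U r) := by
          refine intervalIntegral.integral_mono_on_of_le_Ioo hs.1 hvi.intervalIntegrable
            (hi1.add hi2) fun r hr => ?_
          have hrt : r ≤ t := hr.2.le.trans hs.2
          have hrT : r ∈ Ioc 0 T := ⟨hr.1, hrt.trans ht.2⟩
          have h1 := hle r hrT
          rw [huv r ⟨hr.1.le, hrT.2⟩] at h1
          have h2 := hΦ ⟨hr.1.le, hrT.2⟩ htI hrt
          rw [hv, indicator_of_mem hrT]
          linarith
      _ = A * (s ^ β / β) + s * Φ t + K * V s := by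
          rw [intervalIntegral.integral_add hi1 hi2, intervalIntegral.integral_add
            (hp.const_mul A) intervalIntegrable_const, intervalIntegral.integral_const_mul,
            intervalIntegral.integral_const_mul, intervalIntegral.integral_const,
            integral_rpow (Or.inl (by linarith)), sub_add_cancel, Real.zero_rpow hβ.ne']
          simp [hV]
      _ ≤ A * (t ^ β / β) + t * Φ t + K * V s := by
          have := hs.2
          have := hs.1
          gcongr
      _ = _ := by rw [hΨ]; ring
  have hΨ0 : 0 ≤ Ψ := by
    have := ht.1
    positivity
  have hVt := norm_le_gronwallBound_of_norm_deriv_right_le (f := V) (f' := U) (δ := 0) (K := K)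
    (ε := Ψ) (a := 0) (b := t) (fun s _ => (hVd s).continuousAt.continuousWithinAt)
    (fun s _ => (hVd s).hasDerivWithinAt) (by simp [hV]) (fun s hs => by
      rw [Real.norm_of_nonneg (hU0 s hs.1), Real.norm_of_nonneg (hV0 s hs.1)]
      exact hUV s ⟨hs.1, hs.2.le⟩) t ⟨ht.1.le, le_rfl⟩
  rw [gronwallBound_of_K_ne_0 hK.ne', Real.norm_of_nonneg (hV0 t ht.1.le)] at hVt
  simp only [zero_mul, zero_add, sub_zero] at hVt
  have hUt : U t ≤ Ψ * Real.exp (K * T) := by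
    have h1 := hUV t ⟨ht.1.le, le_rfl⟩
    have h2 : K * V t ≤ Ψ * (Real.exp (K * t) - 1) := by
      calc K * V t ≤ K * (Ψ / K * (Real.exp (K * t) - 1)) := by gcongr
        _ = _ := by field_simp
    have h3 : Real.exp (K * t) ≤ Real.exp (K * T) := by
      have := ht.2
      gcongr
    nlinarith
  have hΨle : Ψ ≤ (T / β + T) * (A * t ^ (β - 1) + Φ t) := by
    have h1 : t ^ β = t ^ (β - 1) * t := by
      rw [Real.rpow_sub_one ht.1.ne']; field_simp [ht.1.ne']
    have h2 : 0 ≤ A * t ^ (β - 1) := mul_nonneg hA (Real.rpow_nonneg ht.1.le _)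
    have h3 : A * (t ^ β / β) = t / β * (A * t ^ (β - 1)) := by rw [h1]; ring
    have h4 : t / β * (A * t ^ (β - 1)) ≤ T / β * (A * t ^ (β - 1)) := by
      have := ht.2
      gcongr
    have h5 : t * Φ t ≤ T * Φ t := by
      have := ht.2
      gcongr
    have h6 : 0 ≤ T * (A * t ^ (β - 1)) := by positivity
    have h7 : 0 ≤ T / β * Φ t := by positivity
    rw [hΨ, h3]
    linarith
  have hfin := hle t ht
  rw [huv t htI] at hfin
  calc u t ≤ A * t ^ (β - 1) + Φ t + K * U t := hfin
    _ ≤ A * t ^ (β - 1) + Φ t +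
          K * ((T / β + T) * (A * t ^ (β - 1) + Φ t) * Real.exp (K * T)) := by
        have : U t ≤ (T / β + T) * (A * t ^ (β - 1) + Φ t) * Real.exp (K * T) :=
          hUt.trans (mul_le_mul_of_nonneg_right hΨle (Real.exp_nonneg _))
        gcongr
    _ = _ := by ring

/-- Both estimates for a single mode, uniformly in the eigenvalue. -/
theorem IsModeSolution.estimate {α T L b₀ B lam₁ θ : ℝ} (hα : 0 < α) (hα1 : α < 1) (hT : 0 < T)
    (hL : 0 ≤ L) (hb₀ : 0 < b₀) (hlam₁ : 0 < lam₁) (hθ0 : 0 < θ) (hθ1 : θ ≤ 1) :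
    ∃ C : ℝ, 0 < C ∧ ∀ (lam : ℝ) (b f w g Φ : ℝ → ℝ), lam₁ ≤ lam →
      (∀ t ∈ Icc 0 T, b₀ ≤ b t ∧ b t ≤ B) →
      (∀ t ∈ Icc 0 T, ∀ s ∈ Icc 0 T, |b t - b s| ≤ L * |t - s|) →
      IsModeSolution α T lam b f w g → MonotoneOn Φ (Icc 0 T) →
      (∀ t ∈ Icc 0 T, |f t| ≤ Φ t) → ∀ t ∈ Ioc 0 T,
      |g t| ≤ C * (t ^ (α - 1) * |w 0| + Φ t) ∧
      lam * |g t| ≤ C * (t ^ (θ * α - 1) * (lam ^ θ * |w 0|) + Φ t) := by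
  -- The added `1` keeps the Gronwall coefficient positive when `L = 0`.
  have hK : 0 < L / b₀ + 1 := by positivity
  have hΓ := Real.Gamma_pos_of_pos hα
  obtain ⟨C₁, hC₁, h₁⟩ := gronwall_singular hT hα hK
  obtain ⟨C₂, hC₂, h₂⟩ := gronwall_singular hT (mul_pos hθ0 hα) hK
  set c₁ := 1 / Real.Gamma α + 1 / (lam₁ * b₀) with hc₁
  set c₂ := (1 / Real.Gamma α) ^ θ * (1 / b₀) ^ (1 - θ) + 1 / b₀ with hc₂
  have hc₁0 : 0 < c₁ := by positivity
  have hc₂0 : 0 < c₂ := by positivity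
  refine ⟨C₁ * c₁ + C₂ * c₂, by positivity, fun lam b f w g Φ hlam hb hbL h hΦ hf t ht => ?_⟩
  have hlam0 : 0 < lam := hlam₁.trans_le hlam
  have h0T : (0 : ℝ) ∈ Icc 0 T := ⟨le_rfl, hT.le⟩
  have hbB : ∀ t ∈ Icc 0 T, |b t| ≤ B := fun t ht => by
    rw [abs_of_pos (hb₀.trans_le (hb t ht).1)]; exact (hb t ht).2
  have hg := h.intervalIntegrable hα hα1.le hT hlam0.le hbB hbL
  have hΦ0 : 0 ≤ Φ 0 := (abs_nonneg _).trans (hf 0 h0T)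
  have hΦn : ∀ t ∈ Icc 0 T, 0 ≤ Φ t := fun t ht => (abs_nonneg _).trans (hf t ht)
  have main : ∀ t ∈ Ioc 0 T, |g t| ≤ |w 0| * rlResolvent α (lam * b t) t +
      1 / (lam * b₀) * Φ t + (L / b₀ + 1) * ∫ s in (0 : ℝ)..t, |g s| := by
    intro t ht
    have htI : t ∈ Icc 0 T := ⟨ht.1.le, ht.2⟩
    have hbt := (hb t htI).1
    have hbt0 := hb₀.trans_le hbt
    have hΦt := hΦn t htI
    refine (h.abs_le_add_integral hα hα1 hlam0 hbL hL hg ht hbt0 fun s hs => (hf s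
      ⟨hs.1, hs.2.trans ht.2⟩).trans (hΦ ⟨hs.1, hs.2.trans ht.2⟩ htI hs.2)).trans ?_
    have hJ : 0 ≤ ∫ s in (0 : ℝ)..t, |g s| :=
      intervalIntegral.integral_nonneg ht.1.le fun _ _ => abs_nonneg _
    have e1 : Φ t / (lam * b t) ≤ 1 / (lam * b₀) * Φ t := by
      rw [one_div_mul_eq_div]; gcongr
    have e2 : L / b t ≤ L / b₀ + 1 := by
      have : L / b t ≤ L / b₀ := by gcongr
      linarith
    gcongr
  have hpow : ∀ t ∈ Ioc 0 T, lam * rlResolvent α (lam * b t) t ≤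
      (1 / Real.Gamma α) ^ θ * (1 / b₀) ^ (1 - θ) * lam ^ θ * t ^ (θ * α - 1) := by
    intro t ht
    have hbt := (hb t ⟨ht.1.le, ht.2⟩).1
    have hbt0 := hb₀.trans_le hbt
    have h1 := rlResolvent_le_rpow hα hα1 (mul_pos hlam0 hbt0) hθ0.le hθ1 ht.1
    have he := (rlResolvent_pos hα hα1 (mul_pos hlam0 hbt0) ht.1).le
    -- Of the factor `λ`, the share `λ^(1-θ)` is absorbed by the resolvent and `λ^θ` is left for the
    -- initial value.
    have e1 : lam = (1 / b t) ^ (1 - θ) * lam ^ θ * (lam * b t) ^ (1 - θ) := by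
      have : lam ^ θ * lam ^ (1 - θ) = lam := by
        rw [← Real.rpow_add hlam0]; simp
      rw [Real.mul_rpow hlam0.le hbt0.le, Real.div_rpow one_pos.le hbt0.le, Real.one_rpow]
      have hne := (Real.rpow_pos_of_pos hbt0 (1 - θ)).ne'
      field_simp
      exact this.symm
    calc lam * rlResolvent α (lam * b t) t
        = (1 / b t) ^ (1 - θ) * lam ^ θ *
          ((lam * b t) ^ (1 - θ) * rlResolvent α (lam * b t) t) := by
          rw [← mul_assoc, ← e1]
      _ ≤ (1 / b₀) ^ (1 - θ) * lam ^ θ * ((1 / Real.Gamma α) ^ θ * t ^ (θ * α - 1)) := by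
          have : 0 ≤ 1 - θ := by linarith
          gcongr
      _ = _ := by ring
  have htI : t ∈ Icc 0 T := ⟨ht.1.le, ht.2⟩
  have hΦt := hΦn t htI
  constructor
  · have := h₁ (fun s => |g s|) (fun s => 1 / (lam₁ * b₀) * Φ s) (1 / Real.Gamma α * |w 0|)
      (by positivity) hg.abs (fun _ _ => abs_nonneg _)
      (fun x hx y hy hxy => mul_le_mul_of_nonneg_left (hΦ hx hy hxy) (by positivity))
      (by positivity) (fun s hs => ?_) t ht
    · have hx : 0 ≤ t ^ (α - 1) * |w 0| := mul_nonneg (Real.rpow_nonneg ht.1.le _) (abs_nonneg _)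
      calc |g t| ≤ _ := this
        _ ≤ C₁ * (c₁ * (t ^ (α - 1) * |w 0| + Φ t)) := by
          gcongr
          have q1 : 0 ≤ 1 / (lam₁ * b₀) * (t ^ (α - 1) * |w 0|) := by positivity
          have q2 : 0 ≤ 1 / Real.Gamma α * Φ t := by positivity
          rw [hc₁]; linarith
        _ ≤ _ := by
          rw [← mul_assoc]
          gcongr
          have : 0 < C₂ * c₂ := by positivity
          linarith
    · have hbs := hb₀.trans_le (hb s ⟨hs.1.le, hs.2⟩).1
      have q1 := rlResolvent_le_rlKernel hα hα1 (mul_pos hlam0 hbs) hs.1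
      have q2 : |w 0| * rlResolvent α (lam * b s) s ≤
          1 / Real.Gamma α * |w 0| * s ^ (α - 1) := by
        calc |w 0| * rlResolvent α (lam * b s) s ≤ |w 0| * rlKernel α s := by gcongr
          _ = _ := by rw [rlKernel]; ring
      have q3 : 1 / (lam * b₀) * Φ s ≤ 1 / (lam₁ * b₀) * Φ s := by
        have := hΦn s ⟨hs.1.le, hs.2⟩
        gcongr
      linarith [main s hs]
  · have := h₂ (fun s => lam * |g s|) (fun s => 1 / b₀ * Φ s)
      ((1 / Real.Gamma α) ^ θ * (1 / b₀) ^ (1 - θ) * lam ^ θ * |w 0|)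
      (by positivity) (hg.abs.const_mul lam) (fun _ _ => by positivity)
      (fun x hx y hy hxy => mul_le_mul_of_nonneg_left (hΦ hx hy hxy) (by positivity))
      (by positivity) (fun s hs => ?_) t ht
    · have hx : 0 ≤ t ^ (θ * α - 1) * (lam ^ θ * |w 0|) :=
        mul_nonneg (Real.rpow_nonneg ht.1.le _) (by positivity)
      calc lam * |g t| ≤ _ := this
        _ ≤ C₂ * (c₂ * (t ^ (θ * α - 1) * (lam ^ θ * |w 0|) + Φ t)) := by
          gcongr
          have q1 : 0 ≤ 1 / b₀ * (t ^ (θ * α - 1) * (lam ^ θ * |w 0|)) := by positivity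
          have q2 : 0 ≤ (1 / Real.Gamma α) ^ θ * (1 / b₀) ^ (1 - θ) * Φ t := by positivity
          rw [hc₂]; linarith
        _ ≤ _ := by
          rw [← mul_assoc]
          gcongr
          have : 0 < C₁ * c₁ := by positivity
          linarith
    · have q1 := mul_le_mul_of_nonneg_left (main s hs) hlam0.le
      have q2 := mul_le_mul_of_nonneg_right (hpow s hs) (abs_nonneg (w 0))
      have q3 : lam * (1 / (lam * b₀) * Φ s) = 1 / b₀ * Φ s := by field_simp
      rw [intervalIntegral.integral_const_mul]
      linarith

/-! ### Expansion in Dirichlet eigenfunctions -/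

theorem intervalIntegral_indicator_comp_add {E : Type*} [NormedAddCommGroup E] [NormedSpace ℝ E]
    {p q : ℝ} (hpq : p < q) (G : ℝ → E) :
    ∫ x in (-(q - p))..(q - p), (Ioo p q).indicator G (p + x) = ∫ y in Ioo p q, G y := by
  rw [intervalIntegral.integral_comp_add_left (fun y => (Ioo p q).indicator G y) p,
    intervalIntegral.integral_of_le (by linarith), setIntegral_indicator measurableSet_Ioo,
    inter_eq_self_of_subset_right]
  exact fun y hy => ⟨by linarith [hy.1], by linarith [hy.2]⟩

theorem intervalIntegral_indicator_comp_sub {E : Type*} [NormedAddCommGroup E] [NormedSpace ℝ E]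
    {p q : ℝ} (hpq : p < q) (G : ℝ → E) :
    ∫ x in (-(q - p))..(q - p), (Ioo p q).indicator G (p - x) = ∫ y in Ioo p q, G y := by
  have h := intervalIntegral.integral_comp_neg (a := -(q - p)) (b := q - p)
    (fun x => (Ioo p q).indicator G (p + x))
  rw [neg_neg, intervalIntegral_indicator_comp_add hpq G] at h
  exact h

/-- The points `p + x` and `p - x` are never both in `Ω`, so the cross term vanishes. -/
theorem sq_sub_indicator {p q : ℝ} (u : ℝ → ℝ) (x : ℝ) :
    ((Ioo p q).indicator u (p + x) - (Ioo p q).indicator u (p - x)) ^ 2 =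
      (Ioo p q).indicator (fun y => u y ^ 2) (p + x) +
        (Ioo p q).indicator (fun y => u y ^ 2) (p - x) := by
  by_cases h1 : p + x ∈ Ioo p q
  · have h2 : p - x ∉ Ioo p q := fun h => by linarith [h1.1, h.1]
    simp [indicator_of_mem h1, indicator_of_notMem h2]
  · by_cases h2 : p - x ∈ Ioo p q
    · simp [indicator_of_notMem h1, indicator_of_mem h2]
    · simp [indicator_of_notMem h1, indicator_of_notMem h2]

/-- Fourier coefficients of the odd extension. -/
theorem fourierCoeffOn_odd_extension {p q : ℝ} (hpq : p < q) {u : ℝ → ℝ}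
    (hu : IntegrableOn u (Ioo p q)) (h : -(q - p) < q - p) (n : ℤ) :
    fourierCoeffOn h (fun x => (((Ioo p q).indicator u (p + x) -
      (Ioo p q).indicator u (p - x) : ℝ) : ℂ)) n =
      -Complex.I / (q - p) *
        ((∫ y in Ioo p q, u y * Real.sin (n * Real.pi / (q - p) * (y - p)) : ℝ) : ℂ) := by
  have hl : 0 < q - p := sub_pos.2 hpq
  set E : ℝ → ℂ := fun x => fourier (-n) (x : AddCircle (q - p - -(q - p))) with hE
  have hEc : Continuous E := (map_continuous (fourier (-n))).comp (AddCircle.continuous_mk' _)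
  have hEx : ∀ x : ℝ, E x = Complex.exp ((-(n * Real.pi / (q - p) * x) : ℝ) * Complex.I) := by
    intro x
    simp only [hE, fourier_coe_apply]
    congr 1
    have : ((q : ℂ) - p) ≠ 0 := by exact_mod_cast hl.ne'
    push_cast
    field_simp
    ring
  set A : ℝ → ℂ := fun y => E (y - p) * u y with hA
  set B : ℝ → ℂ := fun y => E (p - y) * u y with hB
  have hbd : ∀ x, ‖E x‖ ≤ 1 := fun x => by rw [hEx, Complex.norm_exp_ofReal_mul_I]
  have huC : IntegrableOn (fun y => (u y : ℂ)) (Ioo p q) := hu.ofReal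
  have hAi : IntegrableOn A (Ioo p q) := by
    refine huC.bdd_mul (c := 1) ?_ (Filter.Eventually.of_forall fun y => hbd _)
    exact (hEc.comp (by fun_prop)).aestronglyMeasurable
  have hBi : IntegrableOn B (Ioo p q) := by
    refine huC.bdd_mul (c := 1) ?_ (Filter.Eventually.of_forall fun y => hbd _)
    exact (hEc.comp (by fun_prop)).aestronglyMeasurable
  have hA' : Integrable ((Ioo p q).indicator A) :=
    (integrable_indicator_iff measurableSet_Ioo).2 hAi
  have hB' : Integrable ((Ioo p q).indicator B) :=
    (integrable_indicator_iff measurableSet_Ioo).2 hBi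
  have key : ∀ x, E x • (((Ioo p q).indicator u (p + x) -
      (Ioo p q).indicator u (p - x) : ℝ) : ℂ) =
      (Ioo p q).indicator A (p + x) - (Ioo p q).indicator B (p - x) := by
    intro x
    rw [smul_eq_mul, Complex.ofReal_sub, mul_sub]
    congr 1
    · by_cases h1 : p + x ∈ Ioo p q
      · simp [indicator_of_mem h1, hA]
      · simp [indicator_of_notMem h1]
    · by_cases h1 : p - x ∈ Ioo p q
      · simp [indicator_of_mem h1, hB]
      · simp [indicator_of_notMem h1]
  rw [fourierCoeffOn_eq_integral]
  have e1 : ∫ x in (-(q - p))..(q - p), E x • (((Ioo p q).indicator u (p + x) -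
      (Ioo p q).indicator u (p - x) : ℝ) : ℂ) = ∫ y in Ioo p q, (A y - B y) := by
    simp only [key]
    rw [intervalIntegral.integral_sub (hA'.comp_add_left p).intervalIntegrable
      (hB'.comp_sub_left p).intervalIntegrable, intervalIntegral_indicator_comp_add hpq,
      intervalIntegral_indicator_comp_sub hpq, integral_sub hAi hBi]
  have e2 : ∀ y, A y - B y = (-2 * Complex.I) *
      ((u y * Real.sin (n * Real.pi / (q - p) * (y - p)) : ℝ) : ℂ) := by
    intro y
    simp only [hA, hB, hEx]
    set r := n * Real.pi / (q - p) * (y - p) with hr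
    have : n * Real.pi / (q - p) * (p - y) = -r := by rw [hr]; ring
    rw [this, neg_neg, Complex.exp_mul_I, Complex.exp_mul_I]
    push_cast
    rw [Complex.cos_neg, Complex.sin_neg]
    ring
  rw [e1]
  simp only [e2]
  rw [integral_const_mul, integral_complex_ofReal, Complex.real_smul]
  have : ((q : ℂ) - p) ≠ 0 := by exact_mod_cast hl.ne'
  push_cast
  field_simp
  ring

namespace FracFP

theorem continuous_eigfun (p q : ℝ) (j : ℕ) : Continuous (eigfun p q j) := by
  unfold eigfun; fun_prop

theorem contDiff_eigfun (p q : ℝ) (j : ℕ) : ContDiff ℝ ∞ (eigfun p q j) := by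
  unfold eigfun
  exact contDiff_const.mul (Real.contDiff_sin.comp (by fun_prop))

theorem memLp_eigfun (p q : ℝ) (j : ℕ) :
    MemLp (eigfun p q j) 2 (volume.restrict (Ioo p q)) := by
  refine MemLp.of_bound (continuous_eigfun p q j).aestronglyMeasurable (Real.sqrt (2 / (q - p)))
    (Filter.Eventually.of_forall fun x => ?_)
  rw [eigfun, norm_mul, Real.norm_of_nonneg (Real.sqrt_nonneg _)]
  exact mul_le_of_le_one_right (Real.sqrt_nonneg _) (Real.abs_sin_le_one _)

/-- The functional `u ↦ (u, φ_j)` on `L²(p, q)`. -/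
noncomputable def coeffCLM (p q : ℝ) (j : ℕ) : L2 p q →L[ℝ] ℝ :=
  innerSL ℝ ((memLp_eigfun p q j).toLp)

theorem coeffCLM_apply {p q : ℝ} (j : ℕ) (u : L2 p q) :
    coeffCLM p q j u = pair u (eigfun p q j) := by
  rw [coeffCLM, innerSL_apply_apply, L2.inner_def, pair]
  refine integral_congr_ae ?_
  filter_upwards [(memLp_eigfun p q j).coeFn_toLp] with x hx
  simp [hx]

theorem norm_sq_eq_integral {p q : ℝ} (u : L2 p q) :
    ‖u‖ ^ 2 = ∫ x in Ioo p q, (u : ℝ → ℝ) x ^ 2 := by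
  rw [← real_inner_self_eq_norm_sq, L2.inner_def]
  refine integral_congr_ae (Filter.Eventually.of_forall fun x => ?_)
  simp [sq]

/-- Parseval's identity for the Dirichlet eigenfunctions. -/
theorem hasSum_coeff_sq {p q : ℝ} (hpq : p < q) (u : L2 p q) :
    HasSum (fun j => pair u (eigfun p q j) ^ 2) (‖u‖ ^ 2) := by
  have hl : 0 < q - p := sub_pos.2 hpq
  have h : -(q - p) < q - p := by linarith
  have hmem : MemLp (u : ℝ → ℝ) 2 (volume.restrict (Ioo p q)) := Lp.memLp u
  have hui : IntegrableOn (u : ℝ → ℝ) (Ioo p q) := hmem.integrable (by norm_num)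
  have hsq : IntegrableOn (fun x => (u : ℝ → ℝ) x ^ 2) (Ioo p q) := hmem.integrable_sq
  set v : ℝ → ℝ := (Ioo p q).indicator u with hv
  have hvm : MemLp v 2 volume := (memLp_indicator_iff_restrict measurableSet_Ioo).2 hmem
  -- Extended oddly about `p` to an interval of length `2 (q - p)`, `u` has a pure sine series, and
  -- Parseval for Fourier series applies.
  have hUm : MemLp (fun x => v (p + x) - v (p - x)) 2 volume :=
    (hvm.comp_measurePreserving (measurePreserving_add_left volume p)).sub
      (hvm.comp_measurePreserving (Measure.measurePreserving_sub_left volume p))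
  have hP := hasSum_sq_fourierCoeffOn (f := fun x => ((v (p + x) - v (p - x) : ℝ) : ℂ)) h
    (hUm.ofReal.restrict _)
  have hcoef : ∀ n : ℤ, ‖fourierCoeffOn h (fun x => ((v (p + x) - v (p - x) : ℝ) : ℂ)) n‖ ^ 2 =
      (q - p)⁻¹ ^ 2 *
        (∫ y in Ioo p q, (u : ℝ → ℝ) y * Real.sin (n * Real.pi / (q - p) * (y - p))) ^ 2 := by
    intro n
    have e0 := fourierCoeffOn_odd_extension hpq hui h n
    simp only [← hv] at e0
    rw [e0, norm_mul, mul_pow, Complex.norm_real, norm_div, norm_neg, Complex.norm_I,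
      Real.norm_eq_abs, sq_abs, ← Complex.ofReal_sub, Complex.norm_real,
      Real.norm_of_nonneg hl.le, one_div]
  set S : ℤ → ℝ := fun n =>
    (∫ y in Ioo p q, (u : ℝ → ℝ) y * Real.sin (n * Real.pi / (q - p) * (y - p))) ^ 2 with hS
  have hnorm : ∫ x in (-(q - p))..(q - p), ‖((v (p + x) - v (p - x) : ℝ) : ℂ)‖ ^ 2 =
      2 * ‖u‖ ^ 2 := by
    have hI : Integrable ((Ioo p q).indicator fun x => (u : ℝ → ℝ) x ^ 2) :=
      (integrable_indicator_iff measurableSet_Ioo).2 hsq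
    simp only [Complex.norm_real, Real.norm_eq_abs, sq_abs, hv, sq_sub_indicator]
    rw [intervalIntegral.integral_add (hI.comp_add_left p).intervalIntegrable
      (hI.comp_sub_left p).intervalIntegrable, intervalIntegral_indicator_comp_add hpq,
      intervalIntegral_indicator_comp_sub hpq, norm_sq_eq_integral]
    ring
  rw [hnorm] at hP
  simp only [hcoef] at hP
  have hP2 := hP.mul_left ((q - p) ^ 2)
  have hS2 : HasSum S (2 * ((q - p) / 2 * ‖u‖ ^ 2)) := by
    have hv2 : (q - p) ^ 2 * (q - p - -(q - p))⁻¹ • (2 * ‖u‖ ^ 2) =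
        2 * ((q - p) / 2 * ‖u‖ ^ 2) := by
      rw [smul_eq_mul, sub_neg_eq_add, ← two_mul]
      field_simp
    rw [hv2] at hP2
    refine hP2.congr_fun fun n => ?_
    simp only [hS]
    field_simp
  have hS0 : S 0 = 0 := by simp [hS]
  have hSneg : ∀ n : ℤ, S (-n) = S n := by
    intro n
    simp only [hS]
    rw [← neg_sq, ← integral_neg]
    congr 2
    funext y
    rw [← mul_neg, ← Real.sin_neg]
    congr 2
    push_cast
    ring
  have hpair : ∀ j : ℕ, S (j + 1) = (q - p) / 2 * pair u (eigfun p q j) ^ 2 := by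
    intro j
    have : pair u (eigfun p q j) = Real.sqrt (2 / (q - p)) *
        ∫ y in Ioo p q,
          (u : ℝ → ℝ) y * Real.sin (((j : ℤ) + 1 : ℤ) * Real.pi / (q - p) * (y - p)) := by
      rw [pair, ← integral_const_mul]
      refine integral_congr_ae (Filter.Eventually.of_forall fun y => ?_)
      simp only [eigfun]
      push_cast
      ring
    rw [this, mul_pow, Real.sq_sqrt (by positivity)]
    simp only [hS]
    field_simp
  have hsum1 : Summable fun j : ℕ => S (j + 1) :=
    hS2.summable.comp_injective (i := fun j : ℕ => ((j : ℤ) + 1)) fun a b hab => by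
      simpa using hab
  -- `S` is even and `S 0 = 0`, so the sum over `ℤ` is twice the sum over positive frequencies;
  -- frequency `j + 1` belongs to the eigenfunction of index `j`.
  have hT := HasSum.of_nat_of_neg_add_one (f := S) (m := ∑' j : ℕ, S (j + 1))
    (m' := ∑' j : ℕ, S (j + 1)) ?_ ?_
  · have h2 := hT.unique hS2
    have h3 : ∑' j : ℕ, S (j + 1) = (q - p) / 2 * ‖u‖ ^ 2 := by linarith
    have h4 := hsum1.hasSum
    rw [h3] at h4
    simp only [hpair] at h4
    have h5 := h4.mul_left (2 / (q - p))
    rw [← mul_assoc, div_mul_div_comm, mul_comm 2, div_self (by positivity), one_mul] at h5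
    refine h5.congr_fun fun j => ?_
    field_simp
  · have := (hasSum_nat_add_iff (f := fun n : ℕ => S n) 1 (g := ∑' j : ℕ, S (j + 1))).1 (by
      push_cast
      exact hsum1.hasSum)
    simpa [hS0] using this
  · refine hsum1.hasSum.congr_fun fun n => ?_
    rw [hSneg]

theorem eigval_pos {p q : ℝ} (hpq : p < q) (j : ℕ) : 0 < eigval p q j := by
  have : 0 < q - p := sub_pos.2 hpq
  unfold eigval
  positivity

theorem eigval_zero_le {p q : ℝ} (hpq : p < q) (j : ℕ) : eigval p q 0 ≤ eigval p q j := by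
  have : 0 < q - p := sub_pos.2 hpq
  unfold eigval
  gcongr
  simp

theorem pair_deriv_deriv_eigfun {p q : ℝ} (hpq : p < q) (j : ℕ) (u : L2 p q) :
    pair u (deriv (deriv (eigfun p q j))) = -(eigval p q j * pair u (eigfun p q j)) := by
  rw [pair, pair, ← integral_const_mul, ← integral_neg]
  refine integral_congr_ae (Filter.Eventually.of_forall fun x => ?_)
  have := (eigfun_isDirichletEigenfunction hpq j).2.2 x
  simp only
  rw [show deriv (deriv (eigfun p q j)) x = -(eigval p q j * eigfun p q j x) by linarith]
  ring

/-! ### Reduction to single modes and summation over the modes. -/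

theorem coeffCLM_rlIntegral {p q α T : ℝ} (hα : 0 < α) {W : ℝ → L2 p q}
    (hW : ContinuousOn W (Icc 0 T)) (j : ℕ) {t : ℝ} (ht : t ∈ Icc 0 T) :
    coeffCLM p q j (rlIntegral α W t) =
      cv (rlKernel α) (fun s => pair (W s) (eigfun p q j)) t := by
  have hk : IntervalIntegrable (fun s : ℝ => (t - s) ^ (α - 1)) volume 0 t := by
    have := (intervalIntegral.intervalIntegrable_rpow' (a := 0) (b := t) (r := α - 1)
      (by linarith)).comp_sub_left t
    simp only [sub_self, sub_zero] at this
    exact this.symm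
  have hI : IntervalIntegrable (fun s => (t - s) ^ (α - 1) • W s) volume 0 t := by
    refine hk.smul_continuousOn (hW.mono ?_)
    rw [uIcc_of_le ht.1]; exact Icc_subset_Icc_right ht.2
  rw [rlIntegral, map_smul, ← ContinuousLinearMap.intervalIntegral_comp_comm _ hI, smul_eq_mul,
    cv_comm, cv, ← intervalIntegral.integral_const_mul]
  refine intervalIntegral.integral_congr fun s _ => ?_
  simp only [map_smul, smul_eq_mul, coeffCLM_apply, rlKernel]
  ring

theorem continuousOn_of_eq_add_integral {E : Type*} [NormedAddCommGroup E] [NormedSpace ℝ E]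
    {T : ℝ} (hT : 0 ≤ T) {f f' : ℝ → E}
    (hf' : IntervalIntegrable f' volume 0 T)
    (hf : ∀ t ∈ Icc 0 T, f t = f 0 + ∫ s in (0 : ℝ)..t, f' s) : ContinuousOn f (Icc 0 T) := by
  have h := intervalIntegral.continuousOn_primitive_interval' (μ := volume) (a := 0) hf'
    left_mem_uIcc
  rw [uIcc_of_le hT] at h
  exact (continuousOn_const.add h).congr hf

/-- The coefficients of a solution solve the equation for a single mode. -/
theorem IsSolution.isModeSolution {p q α T : ℝ} (hpq : p < q) (hα : 0 < α) {a : ℝ → ℝ}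
    {f W : ℝ → L2 p q} {W₀ : L2 p q} (h : IsSolution α T a f W₀ W)
    (hf : ContinuousOn f (Icc 0 T)) (j : ℕ) :
    IsModeSolution α T (eigval p q j) (fun t => 1 / a t ^ 2)
      (fun t => pair (f t) (eigfun p q j)) (fun t => pair (W t) (eigfun p q j))
      (fun t => pair (rlDeriv α T W t) (eigfun p q j)) where
  cont_f := by
    simp only [← coeffCLM_apply]
    exact (coeffCLM p q j).continuous.comp_continuousOn hf
  cont_w := by
    simp only [← coeffCLM_apply]
    exact (coeffCLM p q j).continuous.comp_continuousOn h.continuousOn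
  deriv_y := fun t ht => by
    have hd := (coeffCLM p q j).hasFDerivAt.comp_hasDerivWithinAt t
      (h.differentiable t ht).hasDerivWithinAt
    rw [coeffCLM_apply] at hd
    refine hd.congr (fun s hs => ?_) ?_
    · exact (coeffCLM_rlIntegral hα h.continuousOn j hs).symm
    · exact (coeffCLM_rlIntegral hα h.continuousOn j ⟨ht.1.le, ht.2⟩).symm
  deriv_w := fun t ht => by
    have hd := h.equation (eigfun p q j) (contDiff_eigfun p q j)
      (eigfun_isDirichletEigenfunction hpq j).1 (eigfun_isDirichletEigenfunction hpq j).2.1 t ht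
    rw [pair_deriv_deriv_eigfun hpq] at hd
    convert! hd using 1
    ring

theorem abs_pair_le_add_integral {p q T : ℝ} {f f' : ℝ → L2 p q}
    (hf' : IntervalIntegrable f' volume 0 T)
    (hf : ∀ t ∈ Icc 0 T, f t = f 0 + ∫ s in (0 : ℝ)..t, f' s) (j : ℕ) {t : ℝ} (ht : t ∈ Icc 0 T) :
    |pair (f t) (eigfun p q j)| ≤ |pair (f 0) (eigfun p q j)| +
      ∫ s in (0 : ℝ)..t, |pair (f' s) (eigfun p q j)| := by
  simp only [← coeffCLM_apply]
  rw [hf t ht, map_add, ← (coeffCLM p q j).intervalIntegral_comp_comm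
    (hf'.mono_set (uIcc_subset_of_mem ht))]
  refine (abs_add_le _ _).trans (add_le_add le_rfl ?_)
  exact intervalIntegral.abs_integral_le_integral_abs ht.1

theorem intervalIntegrable_abs_pair {p q s t : ℝ} {f' : ℝ → L2 p q}
    (hf' : IntervalIntegrable f' volume s t) (j : ℕ) :
    IntervalIntegrable (fun r => |pair (f' r) (eigfun p q j)|) volume s t := by
  simp only [← coeffCLM_apply]
  exact IntervalIntegrable.abs
    ⟨(coeffCLM p q j).integrable_comp hf'.1, (coeffCLM p q j).integrable_comp hf'.2⟩

/-- Minkowski's integral inequality for the coefficients. -/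
theorem sum_sq_integral_abs_pair_le {p q t : ℝ} (hpq : p < q) (ht : 0 ≤ t) {f' : ℝ → L2 p q}
    (hf' : IntervalIntegrable f' volume 0 t) (S : Finset ℕ) :
    ∑ j ∈ S, (∫ s in (0 : ℝ)..t, |pair (f' s) (eigfun p q j)|) ^ 2 ≤
      (∫ s in (0 : ℝ)..t, ‖f' s‖) ^ 2 := by
  set z : ℕ → ℝ := fun j => ∫ s in (0 : ℝ)..t, |pair (f' s) (eigfun p q j)| with hz
  set Q := ∑ j ∈ S, z j ^ 2 with hQ
  set N := ∫ s in (0 : ℝ)..t, ‖f' s‖ with hN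
  have hQ0 : 0 ≤ Q := Finset.sum_nonneg fun _ _ => sq_nonneg _
  have hN0 : 0 ≤ N := intervalIntegral.integral_nonneg ht fun _ _ => norm_nonneg _
  have hint := fun j => intervalIntegrable_abs_pair hf' j
  -- Duality: the vector `z` is paired with itself, Cauchy–Schwarz is applied under the integral,
  -- and Parseval bounds the coefficients of `f' s` by its norm.
  have h1 : Q ≤ Real.sqrt Q * N := by
    calc Q = ∑ j ∈ S, ∫ s in (0 : ℝ)..t, z j * |pair (f' s) (eigfun p q j)| := by
          refine Finset.sum_congr rfl fun j _ => ?_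
          rw [intervalIntegral.integral_const_mul, sq]
      _ = ∫ s in (0 : ℝ)..t, ∑ j ∈ S, z j * |pair (f' s) (eigfun p q j)| :=
          (intervalIntegral.integral_finsetSum fun j _ => (hint j).const_mul _).symm
      _ ≤ ∫ s in (0 : ℝ)..t, Real.sqrt Q * ‖f' s‖ := by
          refine intervalIntegral.integral_mono_on ht
            (by simpa only [Finset.sum_fn] using
              IntervalIntegrable.sum S fun j _ => (hint j).const_mul (z j))
            (hf'.norm.const_mul _) fun s _ => ?_
          refine (Real.sum_mul_le_sqrt_mul_sqrt S z _).trans ?_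
          refine mul_le_mul_of_nonneg_left ?_ (Real.sqrt_nonneg _)
          rw [Real.sqrt_le_left (norm_nonneg _)]
          simp only [sq_abs]
          have := hasSum_coeff_sq hpq (f' s)
          rw [← this.tsum_eq]
          exact this.summable.sum_le_tsum S fun _ _ => sq_nonneg _
      _ = Real.sqrt Q * N := intervalIntegral.integral_const_mul _ _
  have h2 : Real.sqrt Q ≤ N := by
    rcases hQ0.eq_or_lt with h0 | h0
    · rw [← h0]; simpa
    · have h3 := Real.sqrt_pos.2 h0
      have h4 : Real.sqrt Q * Real.sqrt Q ≤ Real.sqrt Q * N := by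
        rwa [Real.mul_self_sqrt hQ0]
      exact le_of_mul_le_mul_left h4 h3
  calc Q = Real.sqrt Q ^ 2 := (Real.sq_sqrt hQ0).symm
    _ ≤ N ^ 2 := by gcongr

theorem sqrt_tsum_sq_le {x u v z : ℕ → ℝ} {A C Z : ℝ} (hA : 0 ≤ A) (hC : 0 ≤ C)
    (hZ : 0 ≤ Z) (hx : ∀ j, |x j| ≤ C * (A * |u j| + (|v j| + z j)))
    (hu : Summable fun j => u j ^ 2) (hv : Summable fun j => v j ^ 2)
    (hz : ∀ S : Finset ℕ, ∑ j ∈ S, z j ^ 2 ≤ Z ^ 2) :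
    Summable (fun j => x j ^ 2) ∧ Real.sqrt (∑' j, x j ^ 2) ≤
      2 * C * A * Real.sqrt (∑' j, u j ^ 2) + 2 * C * Real.sqrt (∑' j, v j ^ 2) + 2 * C * Z := by
  have hzs : Summable fun j => z j ^ 2 := summable_of_sum_le (fun _ => sq_nonneg _) hz
  have hzt : ∑' j, z j ^ 2 ≤ Z ^ 2 := hzs.tsum_le_of_sum_le hz
  -- The `3` comes from squaring a sum of three terms; after the square root it is rounded up to the
  -- factor `2` of the conclusion.
  set y : ℕ → ℝ := fun j => 3 * C ^ 2 * (A ^ 2 * u j ^ 2 + v j ^ 2 + z j ^ 2) with hy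
  have hys : Summable y := (((hu.mul_left _).add hv).add hzs).mul_left _
  have hxy : ∀ j, x j ^ 2 ≤ y j := fun j => by
    have h1 : x j ^ 2 ≤ (C * (A * |u j| + (|v j| + z j))) ^ 2 := by
      rw [← sq_abs]
      exact pow_le_pow_left₀ (abs_nonneg _) (hx j) 2
    have h2 : (A * |u j| + (|v j| + z j)) ^ 2 ≤ 3 * (A ^ 2 * u j ^ 2 + v j ^ 2 + z j ^ 2) := by
      rw [← sq_abs (u j), ← sq_abs (v j)]
      nlinarith [sq_nonneg (A * |u j| - |v j|), sq_nonneg (A * |u j| - z j),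
        sq_nonneg (|v j| - z j)]
    calc x j ^ 2 ≤ C ^ 2 * (A * |u j| + (|v j| + z j)) ^ 2 := by rw [← mul_pow]; exact h1
      _ ≤ C ^ 2 * (3 * (A ^ 2 * u j ^ 2 + v j ^ 2 + z j ^ 2)) := by gcongr
      _ = y j := by rw [hy]; ring
  have hxs : Summable fun j => x j ^ 2 := hys.of_nonneg_of_le (fun _ => sq_nonneg _) hxy
  refine ⟨hxs, ?_⟩
  set U := Real.sqrt (∑' j, u j ^ 2) with hU
  set V := Real.sqrt (∑' j, v j ^ 2) with hV
  have hU2 : U ^ 2 = ∑' j, u j ^ 2 := Real.sq_sqrt (tsum_nonneg fun _ => sq_nonneg _)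
  have hV2 : V ^ 2 = ∑' j, v j ^ 2 := Real.sq_sqrt (tsum_nonneg fun _ => sq_nonneg _)
  have hU0 : 0 ≤ U := Real.sqrt_nonneg _
  have hV0 : 0 ≤ V := Real.sqrt_nonneg _
  rw [Real.sqrt_le_left (by positivity)]
  have hyt : ∑' j, y j = 3 * C ^ 2 * (A ^ 2 * U ^ 2 + V ^ 2 + ∑' j, z j ^ 2) := by
    rw [hy, tsum_mul_left, ((hu.mul_left _).add hv).tsum_add hzs, (hu.mul_left _).tsum_add hv,
      tsum_mul_left, hU2, hV2]
  have hpoly : 3 * (A ^ 2 * U ^ 2 + V ^ 2 + Z ^ 2) ≤ (2 * (A * U + V + Z)) ^ 2 := by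
    have h1 : 0 ≤ A * U := mul_nonneg hA hU0
    nlinarith [mul_nonneg h1 hV0, mul_nonneg h1 hZ, mul_nonneg hV0 hZ]
  calc ∑' j, x j ^ 2 ≤ ∑' j, y j := hxs.tsum_le_tsum hxy hys
    _ ≤ C ^ 2 * (3 * (A ^ 2 * U ^ 2 + V ^ 2 + Z ^ 2)) := by
        rw [hyt, show 3 * C ^ 2 * (A ^ 2 * U ^ 2 + V ^ 2 + ∑' j, z j ^ 2) =
          C ^ 2 * (3 * (A ^ 2 * U ^ 2 + V ^ 2 + ∑' j, z j ^ 2)) by ring]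
        gcongr
    _ ≤ C ^ 2 * (2 * (A * U + V + Z)) ^ 2 := by gcongr
    _ = _ := by ring

end FracFP

/-! ### Assembly of the mode estimates. -/

theorem mainTheorem1
    (p q : ℝ) (hpq : p < q) (T : ℝ) (hT : 0 < T) (α : ℝ) (hα₀ : 0 < α) (hα₁ : α < 1)
    (ε : ℝ) (hε₀ : 0 < ε) (hε₂ : ε ≤ 2) (c M L : ℝ) (hc : 0 < c) :
    ∃ C : ℝ, 0 < C ∧
      ∀ a : ℝ → ℝ,
        (∀ t ∈ Set.Icc 0 T, c < a t ^ 2 ∧ a t ^ 2 < M) →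
        (∀ t ∈ Set.Icc 0 T, ∀ s ∈ Set.Icc 0 T, |1 / a t ^ 2 - 1 / a s ^ 2| ≤ L * |t - s|) →
      ∀ (f f' : ℝ → FracFP.L2 p q),
        IntervalIntegrable f' MeasureTheory.volume 0 T →
        (∀ t ∈ Set.Icc 0 T, f t = f 0 + ∫ s in (0 : ℝ)..t, f' s) →
      ∀ W₀ : FracFP.L2 p q, FracFP.MemHdot ε W₀ →
      ∀ W : ℝ → FracFP.L2 p q, FracFP.IsSolution α T a f W₀ W →
      ∀ t ∈ Set.Ioc 0 T,
        ‖FracFP.rlDeriv α T W t‖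
            ≤ C * t ^ (α - 1) * ‖W₀‖ + C * ‖f 0‖ + C * ∫ s in (0 : ℝ)..t, ‖f' s‖ ∧
        FracFP.MemHdot 2 (FracFP.rlDeriv α T W t) ∧
        FracFP.hdotNorm 2 (FracFP.rlDeriv α T W t)
            ≤ C * t ^ (ε * α / 2 - 1) * FracFP.hdotNorm ε W₀ + C * ‖f 0‖
              + C * ∫ s in (0 : ℝ)..t, ‖f' s‖ := by
  -- `L` and `M` carry no sign hypothesis: `max L 0` and `max M 1` make the mode constants
  -- admissible while depending only on the given data. The exponent is `θ = ε/2`.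
  obtain ⟨C, hC, hest⟩ := IsModeSolution.estimate (α := α) (T := T) (L := max L 0)
    (b₀ := 1 / max M 1) (B := 1 / c) (lam₁ := FracFP.eigval p q 0) (θ := ε / 2) hα₀ hα₁ hT
    (le_max_right _ _) (by positivity) (FracFP.eigval_pos hpq 0) (by positivity) (by linarith)
  refine ⟨2 * C, by positivity, fun a ha haL f f' hf' hf W₀ hW₀ W hW t ht => ?_⟩
  have htI : t ∈ Icc 0 T := ⟨ht.1.le, ht.2⟩
  have hfc := FracFP.continuousOn_of_eq_add_integral hT.le hf' hf
  have hmode : ∀ j, _ := fun j => hest (FracFP.eigval p q j) (fun t => 1 / a t ^ 2)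
    (fun t => FracFP.pair (f t) (FracFP.eigfun p q j))
    (fun t => FracFP.pair (W t) (FracFP.eigfun p q j))
    (fun t => FracFP.pair (FracFP.rlDeriv α T W t) (FracFP.eigfun p q j))
    (fun t => |FracFP.pair (f 0) (FracFP.eigfun p q j)| +
      ∫ s in (0 : ℝ)..t, |FracFP.pair (f' s) (FracFP.eigfun p q j)|)
    (FracFP.eigval_zero_le hpq j)
    (fun s hs => by
      obtain ⟨h1, h2⟩ := ha s hs
      have h3 : 0 < a s ^ 2 := hc.trans h1
      have h4 : a s ^ 2 ≤ max M 1 := h2.le.trans (le_max_left _ _)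
      constructor <;> gcongr)
    (fun s hs r hr => (haL s hs r hr).trans
      (mul_le_mul_of_nonneg_right (le_max_left _ _) (abs_nonneg _)))
    (hW.isModeSolution hpq hα₀ hfc j)
    (fun s hs r hr hsr => by
      have hi := FracFP.intervalIntegrable_abs_pair
        (hf'.mono_set (uIcc_subset_of_mem hr)) j
      have := intervalIntegral.integral_mono_interval le_rfl hs.1 hsr
        (Filter.Eventually.of_forall fun _ => abs_nonneg _) hi
      simp only
      linarith)
    (fun s hs => FracFP.abs_pair_le_add_integral hf' hf j hs) t ht
  have hf't := hf'.mono_set (uIcc_subset_of_mem htI)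
  have hZ0 : 0 ≤ ∫ s in (0 : ℝ)..t, ‖f' s‖ :=
    intervalIntegral.integral_nonneg ht.1.le fun _ _ => norm_nonneg _
  have hnorm : ∀ u : FracFP.L2 p q,
      Real.sqrt (∑' j, FracFP.pair u (FracFP.eigfun p q j) ^ 2) = ‖u‖ := fun u => by
    rw [(FracFP.hasSum_coeff_sq hpq u).tsum_eq, Real.sqrt_sq (norm_nonneg _)]
  have hsum := fun u : FracFP.L2 p q => (FracFP.hasSum_coeff_sq hpq u).summable
  have hZ := FracFP.sum_sq_integral_abs_pair_le hpq ht.1.le hf't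
  simp only [hW.initial] at hmode
  constructor
  · have := (FracFP.sqrt_tsum_sq_le (Real.rpow_nonneg ht.1.le (α - 1)) hC.le hZ0
      (fun j => (hmode j).1) (hsum W₀) (hsum (f 0)) hZ).2
    rwa [hnorm, hnorm, hnorm] at this
  · have hlam := fun j => FracFP.eigval_pos hpq j
    have e1 : ∀ (u : FracFP.L2 p q) j,
        FracFP.eigval p q j ^ (2 : ℝ) * FracFP.pair u (FracFP.eigfun p q j) ^ 2 =
        (FracFP.eigval p q j * FracFP.pair u (FracFP.eigfun p q j)) ^ 2 := fun u j => by
      rw [mul_pow]; norm_cast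
    have e2 : ∀ (u : FracFP.L2 p q) j,
        FracFP.eigval p q j ^ ε * FracFP.pair u (FracFP.eigfun p q j) ^ 2 =
        (FracFP.eigval p q j ^ (ε / 2) * FracFP.pair u (FracFP.eigfun p q j)) ^ 2 := fun u j => by
      rw [mul_pow, ← Real.rpow_natCast (_ ^ (ε / 2)), ← Real.rpow_mul (hlam j).le]
      congr 2
      push_cast
      ring
    -- Both `Ḣ` norms are now `ℓ²` norms, of `λ g` and of `λ^(ε/2) w(0)`, which are the quantities
    -- in the second mode estimate.
    simp only [FracFP.MemHdot, FracFP.hdotNorm, e1, e2] at hW₀ ⊢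
    have := FracFP.sqrt_tsum_sq_le
      (x := fun j => FracFP.eigval p q j *
        FracFP.pair (FracFP.rlDeriv α T W t) (FracFP.eigfun p q j))
      (Real.rpow_nonneg ht.1.le (ε / 2 * α - 1)) hC.le hZ0
      (fun j => by
        have h := (hmode j).2
        rw [abs_mul, abs_of_pos (hlam j)]
        rw [← abs_of_pos (Real.rpow_pos_of_pos (hlam j) (ε / 2)), ← abs_mul] at h
        exact h) hW₀ (hsum (f 0)) hZ
    rw [hnorm, show ε / 2 * α - 1 = ε * α / 2 - 1 by ring] at this
    exact this
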